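/- Let $p,q,r$ be distinct primes and $M=(pqr)^2$. For $E\subseteq\mathbb{Z}_M$ put $\mathrm{Div}(E)=\{\gcd(a-a',M): a,a'\in E\}$ (with $\gcd(0,M)=M$) and $E(x)=\sum_{e\in E}x^{e}\in\mathbb{Z}[x]$, where the elements of $E$ are represented by integers in $\{0,1,\dots,M-1\}$; let $\Phi_s$ denote the $s$-th cyclotomic polynomial. Let $A,B\subseteq\mathbb{Z}_M$ satisfy $A\oplus B=\mathbb{Z}_M$, that is, every $g\in\mathbb{Z}_M$ can be written as $g=a+b$ with $a\in A$, $b\in B$ in exactly one way. Assume that $|A|=|B|=pqr$, that $0\in A\cap B$, that neither $A$ nor $B$ is contained in a proper subgroup of $\mathbb{Z}_M$, and that $1\notin\mathrm{Div}(B)$. Then: (i) $\Phi_p(x)\Phi_q(x)\Phi_r(x)$ divides $A(x)$; (ii) $p,q,r\in\mathrm{Div}(B)$ and $p^2,q^2,r^2\notin\mathrm{Div}(B)$; (iii) if $p<q<r$, then $p^2qr,\ p^2q^2r,\ p^2qr^2\notin\mathrm{Div}(A)$. -/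

import Mathlib

open Polynomial

/-- `A ⊕ B = ZMod M`: every element of `ZMod M` is `a + b` for exactly one pair
`(a, b)` with `a ∈ A` and `b ∈ B`. -/
def IsFactorization {M : ℕ} (A B : Finset (ZMod M)) : Prop :=
  ∀ g : ZMod M, ∃! ab : ZMod M × ZMod M, ab.1 ∈ A ∧ ab.2 ∈ B ∧ ab.1 + ab.2 = g

/-- The division set `Div(E) = {gcd(a - a', M) : a, a' ∈ E}`. The gcd is computed on the
representative of `a - a'` in `{0, …, M - 1}`; since `gcd(0, M) = M`, always `M ∈ Div(E)`
for nonempty `E`. -/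
def divisionSet {M : ℕ} (E : Finset (ZMod M)) : Set ℕ :=
  {d | ∃ a ∈ E, ∃ a' ∈ E, d = Nat.gcd (a - a').val M}

/-- `E` is contained in a proper subgroup of `ZMod M`. -/
def InProperSubgroup {M : ℕ} (E : Finset (ZMod M)) : Prop :=
  ∃ H : AddSubgroup (ZMod M), H ≠ ⊤ ∧ (E : Set (ZMod M)) ⊆ (H : Set (ZMod M))

/-- The characteristic polynomial `E(x) = ∑_{e ∈ E} x ^ e`, where the elements of `E` are
represented by integers in `{0, …, M - 1}`. -/
noncomputable def charPoly {M : ℕ} (E : Finset (ZMod M)) : ℤ[X] :=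
  ∑ e ∈ E, X ^ e.val

/-! For every $s\mid M$ with $s\ne 1$, $\Phi_s$ divides $A(x)$ or $B(x)$, and by Sands' theorem
$\mathrm{Div}(A)\cap\mathrm{Div}(B)=\{M\}$ (`IsFactorization.eq_of_gcd_eq`). The proof plays these
two facts against each other.

A divisor $\Phi_s$ of $E(x)$ becomes a linear relation between the numbers of elements of $E$ in
residue classes: alternating sums over the vertices of a cuboid vanish
(`coeffPairing_prod_eq_zero`). Since $1\notin\mathrm{Div}(B)$, any two elements of $B$ agree modulo
$p$, $q$ or $r$. As $B$ is not constant modulo any of the three primes, its residue triples either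
agree in two entries with a fixed triple or form a tetrahedron (`majorityType_or_tetrahedralType`).

(i) If $\Phi_p\mid B$, then in the majority case the mixed $\Phi_{pq},\Phi_{pr},\Phi_{pqr}$ cannot
divide $B$, so they divide $A$ together with $\Phi_{p^2}$, and $A$ lies in one class modulo $p$. In
the tetrahedral case $p=2$, and the residues of $A$ give a contradiction.

(ii) If $p\notin\mathrm{Div}(B)$, the majority case passes the mixed polynomials at $p^2$ to $A$,
which makes `UniformOver A p q r` true and puts $p^2$ in both division sets; the tetrahedral case
contradicts the equidistribution coming from $\Phi_{p^2}\mid B$. For the smallest prime, a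
pigeonhole argument puts $p$ or $p^2$ in $\mathrm{Div}(A)$, hence $p^2$, so
$p^2\notin\mathrm{Div}(B)$. This again makes $A$ uniform: $A$ is a complete residue system modulo
$pqr$. The other two squares and (iii) follow from that. -/

/-! ### Pairings with periodic functions and cyclotomic divisors -/

/-- The mask polynomial `∑_{n ∈ E} X ^ n` of a finite set of natural numbers. -/
noncomputable def maskPoly (E : Finset ℕ) : ℤ[X] := ∑ n ∈ E, X ^ n

/-- The linear functional on `ℤ[X]` sending `X ^ n` to `φ n`. -/
noncomputable def coeffPairing (φ : ℕ → ℤ) : ℤ[X] →ₗ[ℤ] ℤ :=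
  Polynomial.lsum fun n => φ n • LinearMap.id

theorem coeffPairing_X_pow (φ : ℕ → ℤ) (n : ℕ) : coeffPairing φ (X ^ n) = φ n := by
  simp [coeffPairing, Polynomial.lsum_apply, ← monomial_one_right_eq_X_pow,
    Polynomial.sum_monomial_index]

theorem coeffPairing_mul_X_pow (φ : ℕ → ℤ) (P : ℤ[X]) (d : ℕ) :
    coeffPairing φ (P * X ^ d) = coeffPairing (fun n => φ (n + d)) P := by
  induction P using Polynomial.induction_on' with
  | add P Q hP hQ => rw [add_mul, map_add, map_add, hP, hQ]
  | monomial n a =>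
    rw [← C_mul_X_pow_eq_monomial, mul_assoc, ← pow_add, ← smul_eq_C_mul, ← smul_eq_C_mul,
      map_smul, map_smul, coeffPairing_X_pow, coeffPairing_X_pow]

theorem coeffPairing_sub (φ ψ : ℕ → ℤ) (P : ℤ[X]) :
    coeffPairing (fun n => φ n - ψ n) P = coeffPairing φ P - coeffPairing ψ P := by
  induction P using Polynomial.induction_on' with
  | add P Q hP hQ => rw [map_add, map_add, map_add, hP, hQ]; ring
  | monomial n a =>
    rw [← C_mul_X_pow_eq_monomial, ← smul_eq_C_mul]
    simp only [map_smul, coeffPairing_X_pow, smul_eq_mul]; ring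

theorem coeffPairing_mul_X_pow_sub_one (φ : ℕ → ℤ) (P : ℤ[X]) (d : ℕ) :
    coeffPairing φ (P * (X ^ d - 1)) = coeffPairing (fun n => φ (n + d) - φ n) P := by
  rw [mul_sub, mul_one, map_sub, coeffPairing_mul_X_pow, coeffPairing_sub]

theorem coeffPairing_maskPoly (φ : ℕ → ℤ) (E : Finset ℕ) :
    coeffPairing φ (maskPoly E) = ∑ n ∈ E, φ n := by
  simp [maskPoly, map_sum, coeffPairing_X_pow]

theorem coeffPairing_eq_zero_of_dvd {φ : ℕ → ℤ} {s : ℕ} (hφ : ∀ n, φ (n + s) = φ n) {P : ℤ[X]}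
    (h : X ^ s - 1 ∣ P) : coeffPairing φ P = 0 := by
  obtain ⟨Q, rfl⟩ := h
  rw [mul_comm, coeffPairing_mul_X_pow_sub_one]
  have : (fun n => φ (n + s) - φ n) = fun n => (φ n - φ n) := by
    funext n; rw [hφ]
  rw [this, coeffPairing_sub, sub_self]

theorem isRelPrime_cyclotomic {m n : ℕ} (hm : 0 < m) (hn : 0 < n) (h : m ≠ n) :
    IsRelPrime (cyclotomic m ℤ) (cyclotomic n ℤ) := by
  rw [(cyclotomic.irreducible hm).isRelPrime_iff_not_dvd]
  intro hd
  have ha := (cyclotomic.irreducible hm).associated_of_dvd (cyclotomic.irreducible hn) hd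
  exact h (cyclotomic_injective
    (eq_of_monic_of_associated (cyclotomic.monic m ℤ) (cyclotomic.monic n ℤ) ha))

/-- A proper divisor $d$ of $s$ divides $s/p$ for some prime $p\mid s$, so $\Phi_d$ divides one
factor of the product; distinct cyclotomic polynomials are coprime. -/
theorem X_pow_sub_one_dvd_cyclotomic_mul_prod {s : ℕ} (hs : 0 < s) :
    (X ^ s - 1 : ℤ[X]) ∣ cyclotomic s ℤ * ∏ p ∈ s.primeFactors, (X ^ (s / p) - 1) := by
  rw [← prod_cyclotomic_eq_X_pow_sub_one hs, ← Nat.cons_self_properDivisors hs.ne',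
    Finset.prod_cons]
  refine mul_dvd_mul_left _ (Finset.prod_dvd_of_isRelPrime ?_ ?_)
  · intro a ha b hb hab
    exact isRelPrime_cyclotomic (Nat.pos_of_mem_properDivisors ha)
      (Nat.pos_of_mem_properDivisors hb) hab
  · intro d hd
    obtain ⟨hds, hlt⟩ := Nat.mem_properDivisors.1 hd
    obtain ⟨k, rfl⟩ := hds
    have hk : k ≠ 1 := by rintro rfl; simp at hlt
    obtain ⟨p, hp, hpk⟩ := Nat.exists_prime_and_dvd hk
    refine dvd_trans ?_ (Finset.dvd_prod_of_mem _ (Nat.mem_primeFactors.2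
      ⟨hp, dvd_mul_of_dvd_right hpk d, hs.ne'⟩))
    refine (cyclotomic.dvd_X_pow_sub_one d ℤ).trans ?_
    obtain ⟨j, rfl⟩ := hpk
    rw [show d * (p * j) / p = d * j by
      rw [mul_left_comm, Nat.mul_div_cancel_left _ hp.pos], pow_mul]
    exact sub_one_dvd_pow_sub_one _ _ 

theorem exists_mul_natCast_eq {m k : ℕ} (hm : 0 < m) (h : k.Coprime m) (t : ZMod m) :
    ∃ w : ℕ, ((k * w : ℕ) : ZMod m) = t := by
  have : NeZero m := ⟨hm.ne'⟩
  refine ⟨((k : ZMod m)⁻¹ * t).val, ?_⟩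
  rw [Nat.cast_mul, ZMod.natCast_zmod_val, ← mul_assoc, ZMod.coe_mul_inv_eq_one _ h, one_mul]

/-- The product is a multiple of $X^s-1$, which every $s$-periodic functional kills. Each factor
$X^{d_p}-1$ acts as a difference operator, so the `d p` are the edges of a cuboid. -/
theorem coeffPairing_prod_eq_zero {s : ℕ} (hs : 0 < s) {P : ℤ[X]} (h : cyclotomic s ℤ ∣ P)
    {φ : ℕ → ℤ} (hφ : ∀ n, φ (n + s) = φ n) (d : ℕ → ℕ)
    (hd : ∀ p ∈ s.primeFactors, s / p ∣ d p) :
    coeffPairing φ (P * ∏ p ∈ s.primeFactors, (X ^ d p - 1)) = 0 := by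
  refine coeffPairing_eq_zero_of_dvd hφ
    ((X_pow_sub_one_dvd_cyclotomic_mul_prod hs).trans (mul_dvd_mul h
      (Finset.prod_dvd_prod_of_dvd _ _ fun p hp => ?_)))
  obtain ⟨k, hk⟩ := hd p hp
  rw [hk, pow_mul]
  exact sub_one_dvd_pow_sub_one _ _

/-! ### Cuboid relations in one, two and three dimensions -/

/-- The indicator function of a residue class. -/
def residueInd (m : ℕ) (u : ZMod m) (n : ℕ) : ℤ := if (n : ZMod m) = u then 1 else 0

theorem residueInd_add {m : ℕ} {u v : ZMod m} {d : ℕ} (h : (d : ZMod m) = u - v) (n : ℕ) :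
    residueInd m u (n + d) = residueInd m v n := by
  have : ((n + d : ℕ) : ZMod m) = u ↔ (n : ZMod m) = v := by
    rw [Nat.cast_add, h]
    constructor <;> intro h'
    · linear_combination h'
    · linear_combination h'
  simp only [residueInd, this]

theorem residueInd_add_of_dvd {m : ℕ} (u : ZMod m) {d : ℕ} (h : m ∣ d) (n : ℕ) :
    residueInd m u (n + d) = residueInd m u n :=
  residueInd_add (by rw [(ZMod.natCast_eq_zero_iff d m).2 h, sub_self]) n

section

variable {p q r m a : ℕ}

theorem sum_residueInd_one (hp : p.Prime) (hm : m = p ^ (a + 1)) {E : Finset ℕ}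
    (h : cyclotomic m ℤ ∣ maskPoly E) {u u' : ZMod m} {t : ℕ} (hu : u' = u + (p ^ a * t : ℕ)) :
    ∑ n ∈ E, (residueInd m u n - residueInd m u' n) = 0 := by
  have hm0 : 0 < m := hm ▸ pow_pos hp.pos _
  have key := coeffPairing_prod_eq_zero hm0 h (φ := residueInd m u')
    (fun n => residueInd_add_of_dvd u' dvd_rfl n) (fun _ => p ^ a * t) (by
      intro l hl
      have : m.primeFactors = {p} := by rw [hm, Nat.primeFactors_prime_pow (by omega) hp]
      rw [this, Finset.mem_singleton] at hl
      subst hl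
      rw [hm, pow_succ, Nat.mul_div_cancel _ hp.pos]
      exact dvd_mul_right _ _)
  rw [show m.primeFactors = {p} by rw [hm, Nat.primeFactors_prime_pow (by omega) hp],
    Finset.prod_singleton, coeffPairing_mul_X_pow_sub_one, coeffPairing_maskPoly] at key
  rw [← key]
  refine Finset.sum_congr rfl fun n _ => ?_
  rw [residueInd_add (v := u) (by rw [hu]; ring)]

theorem sum_residueInd_two (hp : p.Prime) (hq : q.Prime) (hpq : p ≠ q) (hm : m = p ^ (a + 1))
    {E : Finset ℕ} (h : cyclotomic (m * q) ℤ ∣ maskPoly E) {u u' : ZMod m} {t : ℕ}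
    (hu : u' = u + (p ^ a * t : ℕ)) (y y' : ZMod q) :
    ∑ n ∈ E, (residueInd m u n - residueInd m u' n) * (residueInd q y n - residueInd q y' n)
      = 0 := by
  have hm0 : 0 < m := hm ▸ pow_pos hp.pos _
  have hcop : q.Coprime m := hm ▸ ((Nat.coprime_primes hq hp).2 hpq.symm).pow_right _
  obtain ⟨w, hw⟩ := exists_mul_natCast_eq hm0 hcop (t : ZMod m)
  obtain ⟨v, hv⟩ := exists_mul_natCast_eq hq.pos hcop.symm (y' - y)
  have hpf : (m * q).primeFactors = {p, q} := by
    rw [Nat.primeFactors_mul hm0.ne' hq.ne_zero, hm, Nat.primeFactors_prime_pow (by omega) hp,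
      hq.primeFactors]; rfl
  have key := coeffPairing_prod_eq_zero (Nat.mul_pos hm0 hq.pos) h
    (φ := fun n => residueInd m u' n * residueInd q y' n)
    (fun n => by
      simp only [residueInd_add_of_dvd u' (dvd_mul_right m q),
        residueInd_add_of_dvd y' (dvd_mul_left q m)])
    -- The first edge moves the class modulo `m` from `u` to `u'` and fixes the class modulo `q`;
    -- the second does the reverse, moving `y` to `y'`.
    (fun l => if l = p then p ^ a * (q * w) else m * v) (by
      intro l hl
      rw [hpf, Finset.mem_insert, Finset.mem_singleton] at hl
      rcases hl with rfl | rfl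
      · rw [if_pos rfl, hm, show l ^ (a + 1) * q = (l ^ a * q) * l by ring,
          Nat.mul_div_cancel _ hp.pos]
        exact ⟨w, by ring⟩
      · rw [if_neg hpq.symm, Nat.mul_div_cancel _ hq.pos]
        exact dvd_mul_right _ _)
  rw [hpf, Finset.prod_pair hpq, if_pos rfl, if_neg hpq.symm, ← mul_assoc,
    coeffPairing_mul_X_pow_sub_one, coeffPairing_mul_X_pow_sub_one, coeffPairing_maskPoly] at key
  rw [← key]
  refine Finset.sum_congr rfl fun n _ => ?_
  have e1 : ((p ^ a * (q * w) : ℕ) : ZMod m) = u' - u := by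
    rw [Nat.cast_mul, hw, hu]; push_cast; ring
  simp only [residueInd_add_of_dvd u' (dvd_mul_right m v), residueInd_add e1,
    residueInd_add (v := y) hv,
    residueInd_add_of_dvd y (show q ∣ p ^ a * (q * w) from ⟨p ^ a * w, by ring⟩),
    residueInd_add_of_dvd y' (show q ∣ p ^ a * (q * w) from ⟨p ^ a * w, by ring⟩)]
  ring

theorem sum_residueInd_three (hp : p.Prime) (hq : q.Prime) (hr : r.Prime) (hpq : p ≠ q)
    (hqr : q ≠ r) (hpr : p ≠ r) (hm : m = p ^ (a + 1))
    {E : Finset ℕ} (h : cyclotomic (m * q * r) ℤ ∣ maskPoly E) {u u' : ZMod m} {t : ℕ}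
    (hu : u' = u + (p ^ a * t : ℕ)) (y y' : ZMod q) (z z' : ZMod r) :
    ∑ n ∈ E, (residueInd m u n - residueInd m u' n) * (residueInd q y n - residueInd q y' n) *
      (residueInd r z n - residueInd r z' n) = 0 := by
  have hm0 : 0 < m := hm ▸ pow_pos hp.pos _
  have hqm : q.Coprime m := hm ▸ ((Nat.coprime_primes hq hp).2 hpq.symm).pow_right _
  have hrm : r.Coprime m := hm ▸ ((Nat.coprime_primes hr hp).2 hpr.symm).pow_right _
  have hqr' : q.Coprime r := (Nat.coprime_primes hq hr).2 hqr
  obtain ⟨w, hw⟩ := exists_mul_natCast_eq hm0 (hqm.mul_left hrm) (t : ZMod m)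
  obtain ⟨v, hv⟩ := exists_mul_natCast_eq hq.pos (hqm.symm.mul_left hqr'.symm) (y' - y)
  obtain ⟨x, hx⟩ := exists_mul_natCast_eq hr.pos (hrm.symm.mul_left hqr') (z' - z)
  have hpf : (m * q * r).primeFactors = {p, q, r} := by
    rw [Nat.primeFactors_mul (mul_ne_zero hm0.ne' hq.ne_zero) hr.ne_zero,
      Nat.primeFactors_mul hm0.ne' hq.ne_zero, hm, Nat.primeFactors_prime_pow (by omega) hp,
      hq.primeFactors, hr.primeFactors, Finset.union_assoc]; rfl
  have key := coeffPairing_prod_eq_zero (Nat.mul_pos (Nat.mul_pos hm0 hq.pos) hr.pos) h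
    (φ := fun n => residueInd m u' n * residueInd q y' n * residueInd r z' n)
    (fun n => by
      simp only [residueInd_add_of_dvd u' (show m ∣ m * q * r from ⟨q * r, by ring⟩),
        residueInd_add_of_dvd y' (show q ∣ m * q * r from ⟨m * r, by ring⟩),
        residueInd_add_of_dvd z' (show r ∣ m * q * r from ⟨m * q, by ring⟩)])
    (fun l => if l = p then p ^ a * (q * r * w) else if l = q then m * r * v else m * q * x) (by
      intro l hl
      rw [hpf, Finset.mem_insert, Finset.mem_insert, Finset.mem_singleton] at hl
      rcases hl with rfl | rfl | rfl
      · rw [if_pos rfl, hm, show l ^ (a + 1) * q * r = (l ^ a * q * r) * l by ring,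
          Nat.mul_div_cancel _ hp.pos]
        exact ⟨w, by ring⟩
      · rw [if_neg hpq.symm, if_pos rfl, mul_right_comm, Nat.mul_div_cancel _ hq.pos]
        exact dvd_mul_right _ _
      · rw [if_neg hpr.symm, if_neg hqr.symm, Nat.mul_div_cancel _ hr.pos]
        exact dvd_mul_right _ _)
  rw [hpf, Finset.prod_insert (by simp [hpq, hpr]), Finset.prod_pair hqr, if_pos rfl,
    if_neg hpq.symm, if_pos rfl, if_neg hpr.symm, if_neg hqr.symm, ← mul_assoc, ← mul_assoc,
    coeffPairing_mul_X_pow_sub_one, coeffPairing_mul_X_pow_sub_one,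
    coeffPairing_mul_X_pow_sub_one, coeffPairing_maskPoly] at key
  rw [← neg_eq_zero, ← Finset.sum_neg_distrib, ← neg_eq_zero, ← Finset.sum_neg_distrib, ← key]
  refine Finset.sum_congr rfl fun n _ => ?_
  have e1 : ((p ^ a * (q * r * w) : ℕ) : ZMod m) = u' - u := by
    rw [Nat.cast_mul, hw, hu]; push_cast; ring
  simp only [residueInd_add_of_dvd u' (show m ∣ m * r * v from ⟨r * v, by ring⟩),
    residueInd_add_of_dvd u' (show m ∣ m * q * x from ⟨q * x, by ring⟩),
    residueInd_add e1,
    residueInd_add (v := y) hv,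
    residueInd_add_of_dvd y' (show q ∣ m * q * x from ⟨m * x, by ring⟩),
    residueInd_add (v := z) hx,
    residueInd_add_of_dvd z' (show r ∣ m * r * v from ⟨m * v, by ring⟩),
    residueInd_add_of_dvd y (show q ∣ p ^ a * (q * r * w) from ⟨p ^ a * (r * w), by ring⟩),
    residueInd_add_of_dvd y' (show q ∣ p ^ a * (q * r * w) from ⟨p ^ a * (r * w), by ring⟩),
    residueInd_add_of_dvd z (show r ∣ p ^ a * (q * r * w) from ⟨p ^ a * (q * w), by ring⟩),
    residueInd_add_of_dvd z' (show r ∣ p ^ a * (q * r * w) from ⟨p ^ a * (q * w), by ring⟩),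
    residueInd_add_of_dvd z (show r ∣ m * r * v from ⟨m * v, by ring⟩)]
  ring

end

/-! ### Counting elements in residue classes -/

/-- The number of elements of `E` in a residue class. -/
def count₁ (E : Finset ℕ) (m : ℕ) (u : ZMod m) : ℕ :=
  (E.filter fun n : ℕ => (n : ZMod m) = u).card

/-- The number of elements of `E` in an intersection of two residue classes. -/
def count₂ (E : Finset ℕ) (m q : ℕ) (u : ZMod m) (y : ZMod q) : ℕ :=
  (E.filter fun n : ℕ => (n : ZMod m) = u ∧ (n : ZMod q) = y).card

/-- The number of elements of `E` in an intersection of three residue classes. -/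
def count₃ (E : Finset ℕ) (m q r : ℕ) (u : ZMod m) (y : ZMod q) (z : ZMod r) : ℕ :=
  (E.filter fun n : ℕ => (n : ZMod m) = u ∧ (n : ZMod q) = y ∧ (n : ZMod r) = z).card

theorem sum_residueInd (E : Finset ℕ) {m : ℕ} (u : ZMod m) :
    ∑ n ∈ E, residueInd m u n = count₁ E m u := by
  simp only [residueInd, count₁, Finset.sum_boole]

theorem sum_residueInd_mul (E : Finset ℕ) {m q : ℕ} (u : ZMod m) (y : ZMod q) :
    ∑ n ∈ E, residueInd m u n * residueInd q y n = count₂ E m q u y := by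
  simp only [residueInd, count₂, ← Finset.sum_boole, ite_and, ite_mul, one_mul, zero_mul]

theorem sum_residueInd_mul_mul (E : Finset ℕ) {m q r : ℕ} (u : ZMod m) (y : ZMod q)
    (z : ZMod r) :
    ∑ n ∈ E, residueInd m u n * residueInd q y n * residueInd r z n = count₃ E m q r u y z := by
  simp only [residueInd, count₃, ← Finset.sum_boole, ite_and, ite_mul, one_mul, zero_mul]

theorem count₃_swap (E : Finset ℕ) (m q r : ℕ) (u : ZMod m) (y : ZMod q) (z : ZMod r) :
    count₃ E m q r u y z = count₃ E m r q u z y := by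
  unfold count₃
  congr 1
  ext n
  simp only [Finset.mem_filter]
  tauto

theorem count₁_eq_sum (E : Finset ℕ) (m q : ℕ) [NeZero q] (u : ZMod m) :
    count₁ E m u = ∑ y, count₂ E m q u y := by
  unfold count₁ count₂
  rw [Finset.card_eq_sum_card_fiberwise (f := fun n : ℕ => (n : ZMod q))
    (t := Finset.univ) (fun _ _ => Finset.mem_coe.2 (Finset.mem_univ _))]
  simp only [Finset.filter_filter]

theorem count₂_eq_sum (E : Finset ℕ) (m q r : ℕ) [NeZero r] (u : ZMod m) (y : ZMod q) :
    count₂ E m q u y = ∑ z, count₃ E m q r u y z := by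
  unfold count₂ count₃
  rw [Finset.card_eq_sum_card_fiberwise (f := fun n : ℕ => (n : ZMod r))
    (t := Finset.univ) (fun _ _ => Finset.mem_coe.2 (Finset.mem_univ _))]
  simp only [Finset.filter_filter, and_assoc]

theorem card_eq_sum_count₁ (E : Finset ℕ) (m : ℕ) [NeZero m] :
    E.card = ∑ u, count₁ E m u := by
  unfold count₁
  rw [Finset.card_eq_sum_card_fiberwise (f := fun n : ℕ => (n : ZMod m))
    (t := Finset.univ) (fun _ _ => Finset.mem_coe.2 (Finset.mem_univ _))]

theorem count₁_eq_sum_count₃ (E : Finset ℕ) (m q r : ℕ) [NeZero q] [NeZero r] (u : ZMod m) :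
    count₁ E m u = ∑ y, ∑ z, count₃ E m q r u y z := by
  rw [count₁_eq_sum E m q]
  exact Finset.sum_congr rfl fun y _ => count₂_eq_sum E m q r u y

section

variable {p q r m a : ℕ} {E : Finset ℕ} {u u' : ZMod m} {t : ℕ}

theorem count₁_eq (hp : p.Prime) (hm : m = p ^ (a + 1))
    (h : cyclotomic m ℤ ∣ maskPoly E) (hu : u' = u + (p ^ a * t : ℕ)) :
    count₁ E m u = count₁ E m u' := by
  have := sum_residueInd_one hp hm h hu
  rw [Finset.sum_sub_distrib, sum_residueInd, sum_residueInd] at this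
  exact_mod_cast sub_eq_zero.1 this

theorem count₂_add (hp : p.Prime) (hq : q.Prime) (hpq : p ≠ q) (hm : m = p ^ (a + 1))
    (h : cyclotomic (m * q) ℤ ∣ maskPoly E) (hu : u' = u + (p ^ a * t : ℕ)) (y y' : ZMod q) :
    count₂ E m q u y + count₂ E m q u' y' = count₂ E m q u y' + count₂ E m q u' y := by
  have := sum_residueInd_two hp hq hpq hm h hu y y'
  simp only [sub_mul, mul_sub, Finset.sum_sub_distrib, sum_residueInd_mul] at this
  zify
  linarith

theorem count₃_add (hp : p.Prime) (hq : q.Prime) (hr : r.Prime) (hpq : p ≠ q)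
    (hqr : q ≠ r) (hpr : p ≠ r) (hm : m = p ^ (a + 1))
    (h : cyclotomic (m * q * r) ℤ ∣ maskPoly E) (hu : u' = u + (p ^ a * t : ℕ))
    (y y' : ZMod q) (z z' : ZMod r) :
    (count₃ E m q r u' y z - count₃ E m q r u y z : ℤ) +
      (count₃ E m q r u' y' z' - count₃ E m q r u y' z') =
    (count₃ E m q r u' y z' - count₃ E m q r u y z') +
      (count₃ E m q r u' y' z - count₃ E m q r u y' z) := by
  have := sum_residueInd_three hp hq hr hpq hqr hpr hm h hu y y' z z'
  simp only [sub_mul, mul_sub, Finset.sum_sub_distrib, sum_residueInd_mul_mul] at this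
  linarith

/-- Summing the two-dimensional relation over `y'` gives `q` times the claim, because `h₁` makes the
two totals equal. -/
theorem count₂_eq (hp : p.Prime) (hq : q.Prime) (hpq : p ≠ q) (hm : m = p ^ (a + 1))
    (h₁ : cyclotomic m ℤ ∣ maskPoly E) (h₂ : cyclotomic (m * q) ℤ ∣ maskPoly E)
    (hu : u' = u + (p ^ a * t : ℕ)) (y : ZMod q) :
    count₂ E m q u y = count₂ E m q u' y := by
  have : NeZero q := ⟨hq.ne_zero⟩
  have hs : ∑ y', (count₂ E m q u y + count₂ E m q u' y') =
      ∑ y', (count₂ E m q u y' + count₂ E m q u' y) :=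
    Finset.sum_congr rfl fun y' _ => count₂_add hp hq hpq hm h₂ hu y y'
  simp only [Finset.sum_add_distrib, ← count₁_eq_sum, Finset.sum_const, Finset.card_univ,
    ZMod.card, smul_eq_mul] at hs
  have := count₁_eq hp hm h₁ hu
  have hq0 := hq.pos
  refine Nat.eq_of_mul_eq_mul_left hq0 ?_
  omega

/-- By `h₃` the difference of the two layers is a function of `y` plus a function of `z`. Summation
over one variable, combined with `h₁` or `h₂`, removes the dependence on the other. -/
theorem exists_count₃_sub_eq (hp : p.Prime) (hq : q.Prime) (hr : r.Prime) (hpq : p ≠ q)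
    (hqr : q ≠ r) (hpr : p ≠ r) (hm : m = p ^ (a + 1))
    (h₁ : cyclotomic (m * q) ℤ ∣ maskPoly E) (h₂ : cyclotomic (m * r) ℤ ∣ maskPoly E)
    (h₃ : cyclotomic (m * q * r) ℤ ∣ maskPoly E) (hu : u' = u + (p ^ a * t : ℕ)) :
    ∃ D : ℤ, ∀ y z, (count₃ E m q r u' y z - count₃ E m q r u y z : ℤ) = D := by
  have : NeZero q := ⟨hq.ne_zero⟩
  have : NeZero r := ⟨hr.ne_zero⟩
  have hY : ∀ y y' z, (count₃ E m q r u' y z - count₃ E m q r u y z : ℤ) =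
      count₃ E m q r u' y' z - count₃ E m q r u y' z := by
    intro y y' z
    have hs := Finset.sum_congr rfl fun z' (_ : z' ∈ (Finset.univ : Finset (ZMod r))) =>
      count₃_add hp hq hr hpq hqr hpr hm h₃ hu y y' z z'
    have h2 := count₂_add hp hq hpq hm h₁ hu y y'
    simp only [count₂_eq_sum E m q r] at h2
    zify at h2
    simp only [Finset.sum_add_distrib, Finset.sum_sub_distrib, Finset.sum_const,
      Finset.card_univ, ZMod.card, nsmul_eq_mul] at hs
    have hr0 : (r : ℤ) ≠ 0 := by exact_mod_cast hr.ne_zero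
    refine mul_left_cancel₀ hr0 ?_
    linarith
  have hZ : ∀ y z z', (count₃ E m q r u' y z - count₃ E m q r u y z : ℤ) =
      count₃ E m q r u' y z' - count₃ E m q r u y z' := by
    intro y z z'
    have hs := Finset.sum_congr rfl fun y' (_ : y' ∈ (Finset.univ : Finset (ZMod q))) =>
      count₃_add hp hq hr hpq hqr hpr hm h₃ hu y y' z z'
    have h2 := count₂_add hp hr hpr hm h₂ hu z z'
    simp only [count₂_eq_sum E m r q] at h2
    zify at h2
    simp only [count₃_swap E m r q] at h2
    simp only [Finset.sum_add_distrib, Finset.sum_sub_distrib, Finset.sum_const,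
      Finset.card_univ, ZMod.card, nsmul_eq_mul] at hs
    have hq0 : (q : ℤ) ≠ 0 := by exact_mod_cast hq.ne_zero
    refine mul_left_cancel₀ hq0 ?_
    linarith
  exact ⟨_, fun y z => (hY y 0 z).trans (hZ 0 z 0)⟩

end

theorem count₁_pos_iff {E : Finset ℕ} {m : ℕ} {u : ZMod m} :
    0 < count₁ E m u ↔ ∃ n ∈ E, (n : ZMod m) = u := by
  simp [count₁, Finset.card_pos, Finset.Nonempty]

theorem count₂_pos_iff {E : Finset ℕ} {m q : ℕ} {u : ZMod m} {y : ZMod q} :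
    0 < count₂ E m q u y ↔ ∃ n ∈ E, (n : ZMod m) = u ∧ (n : ZMod q) = y := by
  simp [count₂, Finset.card_pos, Finset.Nonempty]

theorem count₃_pos_iff {E : Finset ℕ} {m q r : ℕ} {u : ZMod m} {y : ZMod q} {z : ZMod r} :
    0 < count₃ E m q r u y z ↔
      ∃ n ∈ E, (n : ZMod m) = u ∧ (n : ZMod q) = y ∧ (n : ZMod r) = z := by
  simp [count₃, Finset.card_pos, Finset.Nonempty]

/-! ### Residues modulo p² above a residue modulo p -/

theorem natCast_eq_of_natCast_sq_eq {p a b : ℕ} (h : (a : ZMod (p ^ 2)) = b) :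
    (a : ZMod p) = b := by
  rw [ZMod.natCast_eq_natCast_iff] at h ⊢
  exact h.of_dvd (dvd_pow_self p two_ne_zero)

/-- Reduction from residues modulo `p ^ 2` to residues modulo `p`. -/
abbrev sqReduction (p : ℕ) : ZMod (p ^ 2) →+* ZMod p :=
  ZMod.castHom (dvd_pow_self p two_ne_zero) (ZMod p)

theorem sqReduction_surjective (p : ℕ) : Function.Surjective (sqReduction p) :=
  ZMod.castHom_surjective _

section

variable {p q r : ℕ} {E : Finset ℕ}

theorem exists_eq_add_of_sqReduction_eq (hp : p.Prime) {u u' : ZMod (p ^ 2)}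
    (h : sqReduction p u = sqReduction p u') : ∃ t : ℕ, u' = u + (p ^ 1 * t : ℕ) := by
  have : NeZero (p ^ 2) := ⟨pow_ne_zero _ hp.ne_zero⟩
  have h1 : ((u' - u).val : ZMod p) = 0 := by
    rw [← map_natCast (sqReduction p), ZMod.natCast_zmod_val, map_sub, h, sub_self]
  obtain ⟨t, ht⟩ := (ZMod.natCast_eq_zero_iff _ _).1 h1
  refine ⟨t, ?_⟩
  rw [pow_one, ← ht, ZMod.natCast_zmod_val]
  ring

theorem sqReduction_add (u : ZMod (p ^ 2)) (t : ℕ) :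
    sqReduction p (u + ((p ^ 1 * t : ℕ) : ZMod (p ^ 2))) = sqReduction p u := by
  rw [map_add, map_natCast, (ZMod.natCast_eq_zero_iff (p ^ 1 * t) p).2 ⟨t, by ring⟩, add_zero]

theorem exists_ne_sqReduction_eq (hp : p.Prime) (u : ZMod (p ^ 2)) :
    ∃ u', u' ≠ u ∧ sqReduction p u = sqReduction p u' := by
  refine ⟨u + (p ^ 1 * 1 : ℕ), fun h => ?_, (sqReduction_add u 1).symm⟩
  rw [add_eq_left, ZMod.natCast_eq_zero_iff] at h
  have := Nat.le_of_dvd (by simp [hp.pos]) h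
  have h2 := hp.two_le
  nlinarith

theorem card_filter_sqReduction (hp : p.Prime) [NeZero (p ^ 2)] (x : ZMod p) :
    (Finset.univ.filter fun u => sqReduction p u = x).card = p := by
  obtain ⟨u, rfl⟩ := sqReduction_surjective p x
  conv_rhs => rw [← Finset.card_range p]
  symm
  refine Finset.card_bij (fun t _ => u + (p ^ 1 * t : ℕ)) ?_ ?_ ?_
  · intro t _
    simp only [Finset.mem_filter, Finset.mem_univ, true_and]
    exact sqReduction_add u t
  · intro t ht t' ht' h
    rw [add_right_inj, ZMod.natCast_eq_natCast_iff, pow_one, pow_two] at h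
    have := Nat.ModEq.mul_left_cancel' hp.ne_zero h
    exact Nat.ModEq.eq_of_lt_of_lt this (Finset.mem_range.1 ht) (Finset.mem_range.1 ht')
  · intro u' hu'
    obtain ⟨t, rfl⟩ := exists_eq_add_of_sqReduction_eq hp (Finset.mem_filter.1 hu').2.symm
    refine ⟨t % p, Finset.mem_range.2 (Nat.mod_lt _ hp.pos), ?_⟩
    rw [add_right_inj, ZMod.natCast_eq_natCast_iff, pow_one, pow_two]
    exact (Nat.mod_modEq t p).mul_left' p

theorem count₁_eq_sum_sq [NeZero (p ^ 2)] (x : ZMod p) :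
    count₁ E p x =
      ∑ u ∈ Finset.univ.filter (fun u => sqReduction p u = x), count₁ E (p ^ 2) u := by
  unfold count₁
  rw [Finset.card_eq_sum_card_fiberwise (f := fun n : ℕ => (n : ZMod (p ^ 2)))
    (t := Finset.univ.filter (fun u => sqReduction p u = x))]
  · refine Finset.sum_congr rfl fun u hu => ?_
    rw [Finset.filter_filter]
    congr 1
    refine Finset.filter_congr fun n _ => ⟨fun h => h.2, fun h => ⟨?_, h⟩⟩
    rw [← (Finset.mem_filter.1 hu).2, ← h, map_natCast]
  · intro n hn
    simp only [Finset.coe_filter, Finset.mem_univ, true_and, Set.mem_ofPred_eq, map_natCast] at hn ⊢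
    exact hn.2

theorem count₁_eq_mul_of_forall_eq (hp : p.Prime) {u : ZMod (p ^ 2)}
    (h : ∀ u', sqReduction p u = sqReduction p u' → count₁ E (p ^ 2) u = count₁ E (p ^ 2) u') :
    count₁ E p (sqReduction p u) = p * count₁ E (p ^ 2) u := by
  have : NeZero (p ^ 2) := ⟨pow_ne_zero _ hp.ne_zero⟩
  rw [count₁_eq_sum_sq, Finset.sum_congr rfl fun u' hu' =>
    (h u' (Finset.mem_filter.1 hu').2.symm).symm, Finset.sum_const, card_filter_sqReduction hp,
    smul_eq_mul]

theorem count₁_sq_eq (hp : p.Prime) (h : cyclotomic (p ^ 2) ℤ ∣ maskPoly E) {u u' : ZMod (p ^ 2)}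
    (hu : sqReduction p u = sqReduction p u') : count₁ E (p ^ 2) u = count₁ E (p ^ 2) u' := by
  obtain ⟨t, ht⟩ := exists_eq_add_of_sqReduction_eq hp hu
  exact count₁_eq hp rfl h ht

theorem count₁_eq_mul_count₁_sq (hp : p.Prime) (h : cyclotomic (p ^ 2) ℤ ∣ maskPoly E)
    (u : ZMod (p ^ 2)) : count₁ E p (sqReduction p u) = p * count₁ E (p ^ 2) u :=
  count₁_eq_mul_of_forall_eq hp fun _ => count₁_sq_eq hp h

theorem dvd_count₁ (hp : p.Prime) (h : cyclotomic (p ^ 2) ℤ ∣ maskPoly E) (x : ZMod p) :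
    p ∣ count₁ E p x := by
  obtain ⟨u, rfl⟩ := sqReduction_surjective p x
  exact ⟨_, count₁_eq_mul_count₁_sq hp h u⟩

theorem exists_eq_add_pow_zero (hp : p.Prime) (x x' : ZMod p) :
    ∃ t : ℕ, x' = x + (p ^ 0 * t : ℕ) := by
  have : NeZero p := ⟨hp.ne_zero⟩
  refine ⟨(x' - x).val, ?_⟩
  rw [pow_zero, one_mul, ZMod.natCast_zmod_val]
  ring

theorem count₁_prime_eq (hp : p.Prime) (h : cyclotomic p ℤ ∣ maskPoly E) (x x' : ZMod p) :
    count₁ E p x = count₁ E p x' := by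
  obtain ⟨t, ht⟩ := exists_eq_add_pow_zero hp x x'
  exact count₁_eq hp (a := 0) (by ring) h ht

theorem mul_count₁_of_forall_eq (hp : p.Prime)
    (h : ∀ x x' : ZMod p, count₁ E p x = count₁ E p x') (x : ZMod p) :
    p * count₁ E p x = E.card := by
  have : NeZero p := ⟨hp.ne_zero⟩
  rw [card_eq_sum_count₁ E p, Finset.sum_congr rfl fun x' _ => h x' x, Finset.sum_const,
    Finset.card_univ, ZMod.card, smul_eq_mul]

theorem mul_count₁ (hp : p.Prime) (h : cyclotomic p ℤ ∣ maskPoly E) (x : ZMod p) :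
    p * count₁ E p x = E.card :=
  mul_count₁_of_forall_eq hp (count₁_prime_eq hp h) x

theorem count₁_eq_of_card (hp : p.Prime) (hE : E.card = p * q * r)
    (h : cyclotomic p ℤ ∣ maskPoly E) (x : ZMod p) : count₁ E p x = q * r := by
  have := mul_count₁ hp h x
  rw [hE, mul_assoc] at this
  exact Nat.eq_of_mul_eq_mul_left hp.pos this

theorem not_dvd_mul_primes (hp : p.Prime) (hq : q.Prime) (hr : r.Prime) (hpq : p ≠ q)
    (hpr : p ≠ r) : ¬ p ∣ q * r := by
  rw [hp.dvd_mul, Nat.prime_dvd_prime_iff_eq hp hq, Nat.prime_dvd_prime_iff_eq hp hr]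
  tauto

theorem not_cyclotomic_and_sq (hp : p.Prime) (hq : q.Prime) (hr : r.Prime) (hpq : p ≠ q)
    (hpr : p ≠ r) (hE : E.card = p * q * r) :
    ¬ (cyclotomic p ℤ ∣ maskPoly E ∧ cyclotomic (p ^ 2) ℤ ∣ maskPoly E) := by
  rintro ⟨h1, h2⟩
  apply not_dvd_mul_primes hp hq hr hpq hpr
  rw [← count₁_eq_of_card hp hE h1 0]
  exact dvd_count₁ hp h2 0

/-- Call a class modulo $p^2$ above `x` a layer. A layer without empty cells already uses all $qr$
elements above `x`. If every layer had an empty cell, all layers would have equal size and $p$ would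
divide $qr$. -/
theorem exists_full_class (hp : p.Prime) (hq : q.Prime) (hr : r.Prime) (hpq : p ≠ q)
    (hqr : q ≠ r) (hpr : p ≠ r) (hE : E.card = p * q * r) (h : cyclotomic p ℤ ∣ maskPoly E)
    (h₁ : cyclotomic (p ^ 2 * q) ℤ ∣ maskPoly E) (h₂ : cyclotomic (p ^ 2 * r) ℤ ∣ maskPoly E)
    (h₃ : cyclotomic (p ^ 2 * q * r) ℤ ∣ maskPoly E) (x : ZMod p) :
    ∃ u : ZMod (p ^ 2), sqReduction p u = x ∧ (∀ y z, count₃ E (p ^ 2) q r u y z = 1) ∧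
      ∀ a ∈ E, (a : ZMod p) = x → (a : ZMod (p ^ 2)) = u := by
  have : NeZero q := ⟨hq.ne_zero⟩
  have : NeZero r := ⟨hr.ne_zero⟩
  have hx := count₁_eq_of_card hp hE h x
  by_cases hfull : ∃ u : ZMod (p ^ 2), sqReduction p u = x ∧
      ∀ y z, 1 ≤ count₃ E (p ^ 2) q r u y z
  · obtain ⟨u, rfl, hu⟩ := hfull
    have hsub : (E.filter fun n : ℕ => (n : ZMod (p ^ 2)) = u) ⊆
        E.filter fun n : ℕ => (n : ZMod p) = sqReduction p u := by
      intro n hn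
      rw [Finset.mem_filter] at hn ⊢
      refine ⟨hn.1, ?_⟩
      rw [← hn.2, map_natCast]
    have hle : count₁ E (p ^ 2) u ≤ q * r := hx ▸ Finset.card_le_card hsub
    have hsum := count₁_eq_sum_count₃ E (p ^ 2) q r u
    have hone : ∑ y : ZMod q, ∑ z : ZMod r, 1 = q * r := by simp [ZMod.card]
    have hge : q * r ≤ count₁ E (p ^ 2) u := by
      rw [hsum, ← hone]
      exact Finset.sum_le_sum fun y _ => Finset.sum_le_sum fun z _ => hu y z
    refine ⟨u, rfl, ?_, ?_⟩
    · have heq : ∑ y : ZMod q, ∑ z : ZMod r, 1 =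
          ∑ y, ∑ z, count₃ E (p ^ 2) q r u y z := by rw [hone, ← hsum]; omega
      intro y z
      have e1 := (Finset.sum_eq_sum_iff_of_le
        (fun y _ => Finset.sum_le_sum fun z _ => hu y z)).1 heq y (Finset.mem_univ _)
      exact ((Finset.sum_eq_sum_iff_of_le (fun z _ => hu y z)).1 e1 z (Finset.mem_univ _)).symm
    · have heq := Finset.eq_of_subset_of_card_le hsub (by
        change count₁ E p _ ≤ count₁ E (p ^ 2) u; omega)
      intro a ha hax
      have : a ∈ E.filter fun n : ℕ => (n : ZMod p) = sqReduction p u :=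
        Finset.mem_filter.2 ⟨ha, hax⟩
      rw [← heq] at this
      exact (Finset.mem_filter.1 this).2
  · exfalso
    push Not at hfull
    have hD : ∀ u u' : ZMod (p ^ 2), sqReduction p u = x → sqReduction p u' = x →
        count₁ E (p ^ 2) u = count₁ E (p ^ 2) u' := by
      intro u u' hu hu'
      obtain ⟨t, ht⟩ := exists_eq_add_of_sqReduction_eq hp (hu.trans hu'.symm)
      obtain ⟨D, hD⟩ := exists_count₃_sub_eq hp hq hr hpq hqr hpr (m := p ^ 2) (a := 1) rfl h₁ h₂ h₃ ht
      obtain ⟨y, z, h0⟩ := hfull u hu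
      obtain ⟨y', z', h0'⟩ := hfull u' hu'
      have d1 := hD y z
      have d2 := hD y' z'
      -- An empty cell in the layer `u` gives `D ≥ 0`, one in the layer `u'` gives `D ≤ 0`.
      have hD0 : D = 0 := by omega
      rw [count₁_eq_sum_count₃ E (p ^ 2) q r, count₁_eq_sum_count₃ E (p ^ 2) q r]
      refine Finset.sum_congr rfl fun y _ => Finset.sum_congr rfl fun z _ => ?_
      have := hD y z
      omega
    obtain ⟨u, hu⟩ := sqReduction_surjective p x
    have := count₁_eq_mul_of_forall_eq hp fun u' hu' => hD u u' hu (hu' ▸ hu)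
    rw [hu, hx] at this
    exact not_dvd_mul_primes hp hq hr hpq hpr ⟨_, this⟩

/-- Two classes modulo $p$ differ by the same amount $D$ in each of the $qr$ cells, and $\Phi_{p^2}$
forces $p\mid D$. Equal classes would have size $qr$, not a multiple of $p$; otherwise the larger of
two unequal classes has at least $p$ elements in every cell, hence all of `E`. -/
theorem forall_natCast_eq_of_cyclotomic_sq (hp : p.Prime) (hq : q.Prime) (hr : r.Prime)
    (hpq : p ≠ q) (hqr : q ≠ r) (hpr : p ≠ r) (hE : E.card = p * q * r)
    (h : cyclotomic (p ^ 2) ℤ ∣ maskPoly E)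
    (h₁ : cyclotomic (p * q) ℤ ∣ maskPoly E) (h₂ : cyclotomic (p * r) ℤ ∣ maskPoly E)
    (h₃ : cyclotomic (p * q * r) ℤ ∣ maskPoly E) :
    ∃ x : ZMod p, ∀ a ∈ E, (a : ZMod p) = x := by
  have : NeZero q := ⟨hq.ne_zero⟩
  have : NeZero r := ⟨hr.ne_zero⟩
  have key : ∀ x x' : ZMod p, ∃ D : ℤ, (p : ℤ) ∣ D ∧
      ∀ y z, (count₃ E p q r x' y z - count₃ E p q r x y z : ℤ) = D := by
    intro x x'
    obtain ⟨t, ht⟩ := exists_eq_add_pow_zero hp x x'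
    obtain ⟨D, hD⟩ := exists_count₃_sub_eq hp hq hr hpq hqr hpr (a := 0) (by ring) h₁ h₂ h₃ ht
    refine ⟨D, ?_, hD⟩
    have hs : (count₁ E p x' : ℤ) - count₁ E p x = ((q * r : ℕ) : ℤ) * D := by
      rw [count₁_eq_sum_count₃ E p q r, count₁_eq_sum_count₃ E p q r]
      push_cast
      simp only [← Finset.sum_sub_distrib, hD, Finset.sum_const, Finset.card_univ, ZMod.card,
        nsmul_eq_mul]
      ring
    have hd : (p : ℤ) ∣ ((q * r : ℕ) : ℤ) * D := by
      rw [← hs]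
      exact dvd_sub (Int.natCast_dvd_natCast.2 (dvd_count₁ hp h x'))
        (Int.natCast_dvd_natCast.2 (dvd_count₁ hp h x))
    rcases (Nat.prime_iff_prime_int.1 hp).dvd_or_dvd hd with h' | h'
    · exact absurd (Int.natCast_dvd_natCast.1 h') (not_dvd_mul_primes hp hq hr hpq hpr)
    · exact h'
  by_cases hc : ∀ x x' : ZMod p, count₁ E p x = count₁ E p x'
  · exfalso
    have h0 := mul_count₁_of_forall_eq hp hc 0
    rw [hE, mul_assoc] at h0
    have h0 := Nat.eq_of_mul_eq_mul_left hp.pos h0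
    exact not_dvd_mul_primes hp hq hr hpq hpr (h0 ▸ dvd_count₁ hp h 0)
  · push Not at hc
    obtain ⟨x, x', hne⟩ := hc
    wlog hlt : count₁ E p x < count₁ E p x' generalizing x x'
    · exact this x' x hne.symm (by omega)
    obtain ⟨D, ⟨k, hk⟩, hD⟩ := key x x'
    have hpos : 0 < D := by
      by_contra hneg
      push Not at hneg
      refine absurd hlt (not_lt.2 ?_)
      rw [count₁_eq_sum_count₃ E p q r, count₁_eq_sum_count₃ E p q r]
      refine Finset.sum_le_sum fun y _ => Finset.sum_le_sum fun z _ => ?_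
      have := hD y z
      omega
    have hpD : (p : ℤ) ≤ D := Int.le_of_dvd hpos ⟨k, hk⟩
    have hge : p * q * r ≤ count₁ E p x' := by
      have hcst : ∑ y : ZMod q, ∑ z : ZMod r, p = p * q * r := by
        simp only [Finset.sum_const, Finset.card_univ, ZMod.card, smul_eq_mul]; ring
      rw [count₁_eq_sum_count₃ E p q r, ← hcst]
      refine Finset.sum_le_sum fun y _ => Finset.sum_le_sum fun z _ => ?_
      have := hD y z
      omega
    refine ⟨x', fun a ha => ?_⟩
    have := Finset.eq_of_subset_of_card_le (Finset.filter_subset (fun n : ℕ => (n : ZMod p) = x') E)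
      (by rw [hE]; exact hge)
    rw [← this] at ha
    exact (Finset.mem_filter.1 ha).2

end

/-! ### Differences with gcd p or p², and a pigeonhole argument -/

/-- Two elements of `E` are congruent modulo `p`, but not modulo `p ^ 2`, `q` or `r`. -/
def DiffPrime (E : Finset ℕ) (p q r : ℕ) : Prop :=
  ∃ a ∈ E, ∃ b ∈ E, (a : ZMod p) = b ∧ (a : ZMod (p ^ 2)) ≠ b ∧ (a : ZMod q) ≠ b ∧
    (a : ZMod r) ≠ b

/-- Two elements of `E` are congruent modulo `p ^ 2`, but not modulo `q` or `r`. -/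
def DiffPrimeSq (E : Finset ℕ) (p q r : ℕ) : Prop :=
  ∃ a ∈ E, ∃ b ∈ E, (a : ZMod (p ^ 2)) = b ∧ (a : ZMod q) ≠ b ∧ (a : ZMod r) ≠ b

section

variable {p q r : ℕ} {E : Finset ℕ}

theorem DiffPrime.swap (h : DiffPrime E p q r) : DiffPrime E p r q := by
  obtain ⟨a, ha, b, hb, h1, h2, h3, h4⟩ := h
  exact ⟨a, ha, b, hb, h1, h2, h4, h3⟩

theorem DiffPrimeSq.swap (h : DiffPrimeSq E p q r) : DiffPrimeSq E p r q := by
  obtain ⟨a, ha, b, hb, h1, h3, h4⟩ := h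
  exact ⟨a, ha, b, hb, h1, h4, h3⟩

theorem diffPrime_or_diffPrimeSq {a b : ℕ} (ha : a ∈ E) (hb : b ∈ E) (hp : (a : ZMod p) = b)
    (hq : (a : ZMod q) ≠ b) (hr : (a : ZMod r) ≠ b) : DiffPrime E p q r ∨ DiffPrimeSq E p q r := by
  by_cases h : (a : ZMod (p ^ 2)) = b
  · exact Or.inr ⟨a, ha, b, hb, h, hq, hr⟩
  · exact Or.inl ⟨a, ha, b, hb, hp, h, hq, hr⟩

theorem card_filter_natCast_mem (E : Finset ℕ) (m : ℕ) [NeZero m] (S : Finset (ZMod m)) :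
    (E.filter fun n : ℕ => (n : ZMod m) ∈ S).card = ∑ u ∈ S, count₁ E m u := by
  rw [Finset.card_eq_sum_card_fiberwise (s := E.filter fun n : ℕ => (n : ZMod m) ∈ S)
    (f := fun n : ℕ => (n : ZMod m)) (t := S)
    (fun n hn => (Finset.mem_filter.1 (Finset.mem_coe.1 hn)).2)]
  refine Finset.sum_congr rfl fun u hu => ?_
  rw [Finset.filter_filter, count₁]
  congr 1
  exact Finset.filter_congr fun n _ => ⟨fun h => h.2, fun h => ⟨h ▸ hu, h⟩⟩

/-- Without such a pair, each fibre of `E` modulo $p$ lies on a line of the $(q,r)$ grid. Counting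
the elements outside the $q$-residues of the lines in `S` gives $|S|(q-p)\le 0$, so `S` is empty.
Then at most $p<r$ residues modulo $r$ occur, although $\Phi_r$ makes all of them occur. -/
theorem diffPrime_or_diffPrimeSq_of_lt (hp : p.Prime) (hq : q.Prime) (hr : r.Prime)
    (hpq : p < q) (hpr : p < r) (hE : E.card = p * q * r) (h₁ : cyclotomic p ℤ ∣ maskPoly E)
    (h₂ : cyclotomic q ℤ ∣ maskPoly E) (h₃ : cyclotomic r ℤ ∣ maskPoly E) :
    DiffPrime E p q r ∨ DiffPrimeSq E p q r := by
  classical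
  by_contra hcon
  have : NeZero p := ⟨hp.ne_zero⟩
  have : NeZero q := ⟨hq.ne_zero⟩
  have : NeZero r := ⟨hr.ne_zero⟩
  have hline : ∀ a ∈ E, ∀ b ∈ E, (a : ZMod p) = b → (a : ZMod q) = b ∨ (a : ZMod r) = b := by
    intro a ha b hb hab
    by_contra hn
    push Not at hn
    exact hcon (diffPrime_or_diffPrimeSq ha hb hab hn.1 hn.2)
  -- Pairwise collinear points of a grid lie on one line.
  have hcase : ∀ x : ZMod p, (∃ y : ZMod q, ∀ a ∈ E, (a : ZMod p) = x → (a : ZMod q) = y) ∨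
      ∃ z : ZMod r, ∀ a ∈ E, (a : ZMod p) = x → (a : ZMod r) = z := by
    intro x
    by_contra hn
    push Not at hn
    obtain ⟨hn1, hn2⟩ := hn
    obtain ⟨a, ha, hax, -⟩ := hn1 0
    obtain ⟨b, hb, hbx, hba⟩ := hn1 a
    obtain ⟨c, hc, hcx, hca⟩ := hn2 a
    have e1 := (hline b hb a ha (hbx.trans hax.symm)).resolve_left hba
    have e2 := (hline c hc a ha (hcx.trans hax.symm)).resolve_right hca
    rcases hline c hc b hb (hcx.trans hbx.symm) with h | h
    · exact hba (h.symm.trans e2)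
    · exact hca (h.trans e1)
  let S : Finset (ZMod p) := Finset.univ.filter fun x =>
    ∃ y : ZMod q, ∀ a ∈ E, (a : ZMod p) = x → (a : ZMod q) = y
  have hS : ∀ x : ZMod p, ∃ y : ZMod q, x ∈ S → ∀ a ∈ E, (a : ZMod p) = x → (a : ZMod q) = y := by
    intro x
    by_cases hx : x ∈ S
    · obtain ⟨y, hy⟩ := (Finset.mem_filter.1 hx).2
      exact ⟨y, fun _ => hy⟩
    · exact ⟨0, fun h => absurd h hx⟩
  have hT : ∀ x : ZMod p, ∃ z : ZMod r, x ∉ S → ∀ a ∈ E, (a : ZMod p) = x → (a : ZMod r) = z := by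
    intro x
    rcases hcase x with h | ⟨z, hz⟩
    · exact ⟨0, fun h' => absurd (show x ∈ S from Finset.mem_filter.2 ⟨Finset.mem_univ x, h⟩) h'⟩
    · exact ⟨z, fun _ => hz⟩
  choose y₀ hy₀ using hS
  choose z₀ hz₀ using hT
  have hc1 : ∀ x, count₁ E p x = q * r := count₁_eq_of_card hp hE h₁
  have hc2 : ∀ y, count₁ E q y = p * r :=
    count₁_eq_of_card hq (by rw [hE]; ring) h₂
  have hc3 : ∀ z, count₁ E r z = p * q :=
    count₁_eq_of_card hr (by rw [hE]; ring) h₃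
  have hsub : (E.filter fun n : ℕ => (n : ZMod q) ∈ (S.image y₀)ᶜ) ⊆
      E.filter fun n : ℕ => (n : ZMod p) ∈ Sᶜ := by
    intro n hn
    rw [Finset.mem_filter, Finset.mem_compl] at hn ⊢
    exact ⟨hn.1, fun hx => hn.2 (Finset.mem_image.2 ⟨_, hx, (hy₀ _ hx n hn.1 rfl).symm⟩)⟩
  have hle := Finset.card_le_card hsub
  rw [card_filter_natCast_mem, card_filter_natCast_mem] at hle
  simp only [hc1, hc2, Finset.sum_const, smul_eq_mul, Finset.card_compl, ZMod.card] at hle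
  have hSp : S.card ≤ p := by simpa [ZMod.card] using S.card_le_univ
  have him := Finset.card_image_le (s := S) (f := y₀)
  have hS0 : S.card = 0 := by
    have h1 : (q - S.card) * (p * r) ≤ (p - S.card) * (q * r) :=
      (Nat.mul_le_mul_right _ (by omega)).trans hle
    have h2 : (q - S.card) * p ≤ (p - S.card) * q := by
      refine Nat.le_of_mul_le_mul_right ?_ hr.pos
      calc _ = (q - S.card) * (p * r) := by ring
        _ ≤ _ := h1
        _ = _ := by ring
    zify [hSp, hSp.trans hpq.le] at h2
    by_contra hne
    have h3 : (1 : ℤ) ≤ S.card := by exact_mod_cast Nat.one_le_iff_ne_zero.2 hne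
    have h4 : (p : ℤ) < q := by exact_mod_cast hpq
    nlinarith
  rw [Finset.card_eq_zero] at hS0
  have hcard : (Finset.univ.image z₀).card < (Finset.univ : Finset (ZMod r)).card := by
    refine Finset.card_image_le.trans_lt ?_
    simpa [ZMod.card] using hpr
  obtain ⟨z, -, hz⟩ := Finset.exists_mem_notMem_of_card_lt_card hcard
  have hpos : 0 < count₁ E r z := by rw [hc3]; exact Nat.mul_pos hp.pos hq.pos
  obtain ⟨n, hn, rfl⟩ := count₁_pos_iff.1 hpos
  exact hz (Finset.mem_image.2 ⟨(n : ZMod p), Finset.mem_univ _,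
    (hz₀ _ (by simp [hS0]) n hn rfl).symm⟩)

/-- The elements with the residue of `a` modulo `q` meet every lift of its class to modulus $p^2$:
the lift containing `b` and also another one. By `hno` none of them agrees with `b` modulo `r`. -/
theorem diffPrime_and_diffPrimeSq_of_cyclotomic (hp : p.Prime) (hq : q.Prime) (hpq : p ≠ q)
    (h₁ : cyclotomic (p ^ 2) ℤ ∣ maskPoly E) (h₂ : cyclotomic (p ^ 2 * q) ℤ ∣ maskPoly E)
    {a b : ℕ} (ha : a ∈ E) (hb : b ∈ E) (hab : (a : ZMod p) = b) (habq : (a : ZMod q) ≠ b)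
    (hno : ∀ n ∈ E, (n : ZMod p) = a → (n : ZMod q) = a → (n : ZMod r) ≠ b) :
    DiffPrime E p q r ∧ DiffPrimeSq E p q r := by
  have hrow : ∀ u : ZMod (p ^ 2), sqReduction p u = a →
      ∃ n ∈ E, (n : ZMod (p ^ 2)) = u ∧ (n : ZMod q) = a := by
    intro u hu
    obtain ⟨t, ht⟩ := exists_eq_add_of_sqReduction_eq hp (u := (a : ZMod (p ^ 2))) (u' := u)
      (by rw [map_natCast, hu])
    rw [← count₂_pos_iff, ← count₂_eq hp hq hpq rfl h₁ h₂ ht (a : ZMod q), count₂_pos_iff]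
    exact ⟨a, ha, rfl, rfl⟩
  constructor
  · obtain ⟨u, hu, hru⟩ := exists_ne_sqReduction_eq hp (b : ZMod (p ^ 2))
    rw [map_natCast] at hru
    obtain ⟨n, hn, rfl, hnq⟩ := hrow u (hru.symm.trans hab.symm)
    rw [map_natCast] at hru
    exact ⟨n, hn, b, hb, hru.symm, hu, by rwa [hnq],
      hno n hn (hru.symm.trans hab.symm) hnq⟩
  · obtain ⟨n, hn, hnu, hnq⟩ := hrow b (by rw [map_natCast, hab])
    exact ⟨n, hn, b, hb, hnu, by rwa [hnq],
      hno n hn ((natCast_eq_of_natCast_sq_eq hnu).trans hab.symm) hnq⟩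

end

/-! ### Layers supported on a cross -/

section

variable {p q r m a : ℕ} {E : Finset ℕ} {u u' : ZMod m} {t : ℕ}

theorem count₃_eq_zero {E : Finset ℕ} {m q r : ℕ} {u : ZMod m} {y : ZMod q} {z : ZMod r}
    (h : ∀ n ∈ E, (n : ZMod m) = u → (n : ZMod q) = y → (n : ZMod r) ≠ z) :
    count₃ E m q r u y z = 0 := by
  rw [← Nat.le_zero, ← not_lt, count₃_pos_iff]
  rintro ⟨n, hn, h1, h2, h3⟩
  exact h n hn h1 h2 h3

/-- The difference `δ` of the layers vanishes off the cross, so the cuboid relation makes it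
constant on each arm, `d` and `e`, with `d + e` at the center. The total is $qd+re=0$, whence $r\mid
d$. -/
theorem exists_arms_of_cross (hp : p.Prime) (hq : q.Prime) (hr : r.Prime) (hpq : p ≠ q)
    (hqr : q ≠ r) (hpr : p ≠ r) (hm : m = p ^ (a + 1))
    (h₁ : cyclotomic m ℤ ∣ maskPoly E)
    (h₃ : cyclotomic (m * q * r) ℤ ∣ maskPoly E) (hu : u' = u + (p ^ a * t : ℕ))
    {y₀ : ZMod q} {z₀ : ZMod r}
    (hcross : ∀ n ∈ E, ((n : ZMod m) = u ∨ (n : ZMod m) = u') →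
      (n : ZMod q) = y₀ ∨ (n : ZMod r) = z₀) :
    ∃ k : ℤ, (∀ y ≠ y₀, (count₃ E m q r u' y z₀ - count₃ E m q r u y z₀ : ℤ) = r * k) ∧
      ∀ z ≠ z₀, (count₃ E m q r u' y₀ z - count₃ E m q r u y₀ z : ℤ) = -(q * k) := by
  have : NeZero q := ⟨hq.ne_zero⟩
  have : NeZero r := ⟨hr.ne_zero⟩
  have := Fact.mk hq.one_lt
  have := Fact.mk hr.one_lt
  obtain ⟨y₁, hy₁⟩ := exists_ne y₀
  obtain ⟨z₁, hz₁⟩ := exists_ne z₀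
  set δ : ZMod q → ZMod r → ℤ := fun y z => count₃ E m q r u' y z - count₃ E m q r u y z with hδ
  have hcub : ∀ y y' z z', δ y z + δ y' z' = δ y z' + δ y' z := fun y y' z z' =>
    count₃_add hp hq hr hpq hqr hpr hm h₃ hu y y' z z'
  have h0 : ∀ y z, y ≠ y₀ → z ≠ z₀ → δ y z = 0 := by
    intro y z hy hz
    simp only [hδ]
    rw [count₃_eq_zero, count₃_eq_zero, sub_self]
    · rintro n hn hnu rfl rfl
      exact (hcross n hn (Or.inl hnu)).elim hy hz
    · rintro n hn hnu rfl rfl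
      exact (hcross n hn (Or.inr hnu)).elim hy hz
  set d := δ y₁ z₀ with hd
  set e := δ y₀ z₁ with he
  have hdy : ∀ y ≠ y₀, δ y z₀ = d := by
    intro y hy
    have := hcub y y₁ z₀ z₁
    rw [h0 y z₁ hy hz₁, h0 y₁ z₁ hy₁ hz₁] at this
    linarith
  have hez : ∀ z ≠ z₀, δ y₀ z = e := by
    intro z hz
    have := hcub y₀ y₁ z z₁
    rw [h0 y₁ z₁ hy₁ hz₁, h0 y₁ z hy₁ hz] at this
    linarith
  have hform : ∀ y z, δ y z = (if z = z₀ then d else 0) + if y = y₀ then e else 0 := by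
    intro y z
    split_ifs with hz hy hy
    · subst hz hy
      have := hcub y y₁ z z₁
      rw [h0 y₁ z₁ hy₁ hz₁] at this
      linarith
    · subst hz; rw [hdy y hy, add_zero]
    · subst hy; rw [hez z hz, zero_add]
    · rw [h0 y z hy hz, add_zero]
  have hsum : ∑ y, ∑ z, δ y z = 0 := by
    have := count₁_eq hp hm h₁ hu
    rw [count₁_eq_sum_count₃ E m q r, count₁_eq_sum_count₃ E m q r] at this
    simp only [hδ, Finset.sum_sub_distrib]
    rw [sub_eq_zero]
    exact_mod_cast this.symm
  have hqre : (q : ℤ) * d + r * e = 0 := by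
    rw [← hsum]
    simp only [hform, Finset.sum_add_distrib, Finset.sum_ite_eq', Finset.mem_univ, if_true,
      Finset.sum_const, Finset.card_univ, ZMod.card, nsmul_eq_mul]
    rw [← Finset.mul_sum]
    simp
  have hrd : (r : ℤ) ∣ d := by
    have h1 : (r : ℤ) ∣ q * d := ⟨-e, by linarith⟩
    rcases (Nat.prime_iff_prime_int.1 hr).dvd_or_dvd h1 with h | h
    · exact absurd ((Nat.prime_dvd_prime_iff_eq hr hq).1 (Int.natCast_dvd_natCast.1 h)) hqr.symm
    · exact h
  obtain ⟨k, hk⟩ := hrd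
  have hr0 : (r : ℤ) ≠ 0 := by exact_mod_cast hr.ne_zero
  refine ⟨k, fun y hy => (hdy y hy).trans hk, fun z hz => (hez z hz).trans ?_⟩
  refine mul_left_cancel₀ hr0 ?_
  rw [hk] at hqre
  linarith

/-- If the elements of `E` in the class `u'` all lie in the center of a cross, and those in the
class `u` do not, then some mixed cyclotomic polynomials do not divide the mask polynomial. -/
theorem not_cyclotomic_of_center (hp : p.Prime) (hq : q.Prime) (hr : r.Prime) (hpq : p ≠ q)
    (hqr : q ≠ r) (hpr : p ≠ r) (hm : m = p ^ (a + 1))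
    (h₁ : cyclotomic m ℤ ∣ maskPoly E) (hu : u' = u + (p ^ a * t : ℕ))
    {y₀ : ZMod q} {z₀ : ZMod r}
    (hcross : ∀ n ∈ E, (n : ZMod m) = u → (n : ZMod q) = y₀ ∨ (n : ZMod r) = z₀)
    (hcenter : ∀ n ∈ E, (n : ZMod m) = u' → (n : ZMod q) = y₀ ∧ (n : ZMod r) = z₀)
    {b : ℕ} (hb : b ∈ E) (hbu : (b : ZMod m) = u) (hby : (b : ZMod q) ≠ y₀) :
    ¬ cyclotomic (m * q) ℤ ∣ maskPoly E ∧ ¬ cyclotomic (m * q * r) ℤ ∣ maskPoly E := by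
  constructor
  · intro h₂
    have : 0 < count₂ E m q u b := count₂_pos_iff.2 ⟨b, hb, hbu, rfl⟩
    rw [count₂_eq hp hq hpq hm h₁ h₂ hu, count₂_pos_iff] at this
    obtain ⟨n, hn, hnu, hnb⟩ := this
    exact hby (hnb ▸ (hcenter n hn hnu).1)
  · intro h₃
    have := Fact.mk hr.one_lt
    obtain ⟨z₁, hz₁⟩ := exists_ne z₀
    -- The arms are empty in the layer `u'`, so neither arm difference is positive. They equal $rk$
    -- and $-qk$, and `b` makes the first one negative.
    obtain ⟨k, hk1, hk2⟩ := exists_arms_of_cross hp hq hr hpq hqr hpr hm h₁ h₃ hu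
      (y₀ := y₀) (z₀ := z₀) (fun n hn h => h.elim (hcross n hn) fun h => Or.inl (hcenter n hn h).1)
    have e1 := hk1 b hby
    have e2 := hk2 z₁ hz₁
    rw [count₃_eq_zero (u := u') (y := (b : ZMod q)) (z := z₀)
      (fun n hn hnu hy _ => hby (hy ▸ (hcenter n hn hnu).1))] at e1
    rw [count₃_eq_zero (u := u') (z := z₁)
      (fun n hn hnu _ hz => hz₁ (hz ▸ (hcenter n hn hnu).2))] at e2
    have hpos : 0 < count₃ E m q r u b z₀ := count₃_pos_iff.2
      ⟨b, hb, hbu, rfl, (hcross b hb hbu).resolve_left hby⟩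
    have hq0 : (0 : ℤ) < q := by exact_mod_cast hq.pos
    have hr0 : (0 : ℤ) < r := by exact_mod_cast hr.pos
    have hk : k < 0 := by
      by_contra hk
      have := mul_nonneg hr0.le (not_lt.1 hk)
      omega
    have := mul_neg_of_pos_of_neg hq0 hk
    omega

end

/-! ### The two possible shapes of B -/

/-- Every element of `E` agrees with a fixed triple of residues in at least two entries. -/
def MajorityType (E : Finset ℕ) (p q r : ℕ) : Prop :=
  ∃ (x : ZMod p) (y : ZMod q) (z : ZMod r), ∀ n ∈ E,
    ((n : ZMod p) = x ∧ (n : ZMod q) = y) ∨ ((n : ZMod p) = x ∧ (n : ZMod r) = z) ∨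
      ((n : ZMod q) = y ∧ (n : ZMod r) = z)

/-- The residue triples of `E` are the four vertices of a tetrahedron inscribed in a cuboid. -/
def TetrahedralType (E : Finset ℕ) (p q r : ℕ) : Prop :=
  ∃ (x₀ x₁ : ZMod p) (y₀ y₁ : ZMod q) (z₀ z₁ : ZMod r), x₀ ≠ x₁ ∧ y₀ ≠ y₁ ∧ z₀ ≠ z₁ ∧
    (∀ n ∈ E, ((n : ZMod p) = x₀ ∧ (n : ZMod q) = y₀ ∧ (n : ZMod r) = z₀) ∨
      ((n : ZMod p) = x₀ ∧ (n : ZMod q) = y₁ ∧ (n : ZMod r) = z₁) ∨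
      ((n : ZMod p) = x₁ ∧ (n : ZMod q) = y₀ ∧ (n : ZMod r) = z₁) ∨
      ((n : ZMod p) = x₁ ∧ (n : ZMod q) = y₁ ∧ (n : ZMod r) = z₀)) ∧
    (∃ n ∈ E, (n : ZMod p) = x₀ ∧ (n : ZMod q) = y₀ ∧ (n : ZMod r) = z₀) ∧
    (∃ n ∈ E, (n : ZMod p) = x₀ ∧ (n : ZMod q) = y₁ ∧ (n : ZMod r) = z₁) ∧
    (∃ n ∈ E, (n : ZMod p) = x₁ ∧ (n : ZMod q) = y₀ ∧ (n : ZMod r) = z₁) ∧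
    ∃ n ∈ E, (n : ZMod p) = x₁ ∧ (n : ZMod q) = y₁ ∧ (n : ZMod r) = z₀

section

variable {p q r : ℕ} {E : Finset ℕ}

theorem MajorityType.swap_left (h : MajorityType E p q r) : MajorityType E q p r := by
  obtain ⟨x, y, z, h⟩ := h
  refine ⟨y, x, z, fun n hn => ?_⟩
  have := h n hn
  tauto

theorem MajorityType.swap_right (h : MajorityType E p q r) : MajorityType E p r q := by
  obtain ⟨x, y, z, h⟩ := h
  refine ⟨x, z, y, fun n hn => ?_⟩
  have := h n hn
  tauto

theorem TetrahedralType.swap_left (h : TetrahedralType E p q r) : TetrahedralType E q p r := by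
  obtain ⟨x₀, x₁, y₀, y₁, z₀, z₁, hx, hy, hz, h, ⟨a, ha, ha'⟩, ⟨b, hb, hb'⟩, ⟨c, hc, hc'⟩,
    ⟨d, hd, hd'⟩⟩ := h
  refine ⟨y₀, y₁, x₀, x₁, z₀, z₁, hy, hx, hz, fun n hn => ?_, ⟨a, ha, ?_⟩, ⟨c, hc, ?_⟩,
    ⟨b, hb, ?_⟩, ⟨d, hd, ?_⟩⟩
  · have := h n hn
    tauto
  all_goals tauto

theorem TetrahedralType.swap_right (h : TetrahedralType E p q r) : TetrahedralType E p r q := by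
  obtain ⟨x₀, x₁, y₀, y₁, z₀, z₁, hx, hy, hz, h, ⟨a, ha, ha'⟩, ⟨b, hb, hb'⟩, ⟨c, hc, hc'⟩,
    ⟨d, hd, hd'⟩⟩ := h
  refine ⟨x₀, x₁, z₀, z₁, y₀, y₁, hx, hz, hy, fun n hn => ?_, ⟨a, ha, ?_⟩, ⟨b, hb, ?_⟩,
    ⟨d, hd, ?_⟩, ⟨c, hc, ?_⟩⟩
  · have := h n hn
    tauto
  all_goals tauto

/-- The pair `a`, `b` agrees modulo `p`. An element `w` outside that class shares one remaining
residue with each of them, up to exchanging `a` and `b`. The shape is a tetrahedron or a majority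
according to whether the fourth vertex occurs. -/
theorem majorityType_or_tetrahedralType_of_pair
    (hE : ∀ a ∈ E, ∀ b ∈ E, (a : ZMod p) = b ∨ (a : ZMod q) = b ∨ (a : ZMod r) = b)
    (hp : ¬ ∃ x : ZMod p, ∀ n ∈ E, (n : ZMod p) = x)
    (hpair : ∃ a ∈ E, ∃ b ∈ E, (a : ZMod q) ≠ b ∧ (a : ZMod r) ≠ b) :
    MajorityType E p q r ∨ TetrahedralType E p q r := by
  obtain ⟨a, ha, b, hb, hq, hr⟩ := hpair
  have hab := (hE a ha b hb).resolve_right (by tauto)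
  push Not at hp
  obtain ⟨w, hw, hwx⟩ := hp a
  wlog hwa : (w : ZMod q) = a generalizing a b
  · have h1 := hE w hw a ha
    have h2 := hE w hw b hb
    have hwx' : (w : ZMod p) ≠ b := hab ▸ hwx
    refine this b hb a ha hq.symm hr.symm hab.symm hwx' ?_
    have h3 : (w : ZMod r) = a := by tauto
    rcases h2 with h | h | h
    · exact absurd h hwx'
    · exact h
    · exact absurd (h3.symm.trans h) hr
  have hwb : (w : ZMod r) = b := by
    rcases hE w hw b hb with h | h | h
    · exact absurd (h.trans hab.symm) hwx
    · exact absurd (hwa.symm.trans h) hq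
    · exact h
  by_cases hv : ∃ v ∈ E, (v : ZMod p) ≠ a ∧ (v : ZMod q) = b ∧ (v : ZMod r) = a
  · right
    obtain ⟨v, hv, hvx, hvq, hvr⟩ := hv
    have hvw : (v : ZMod p) = w := by
      rcases hE v hv w hw with h | h | h
      · exact h
      · exact absurd (hwa.symm.trans (h.symm.trans hvq)) hq
      · exact absurd (hvr.symm.trans (h.trans hwb)) hr
    refine ⟨a, w, a, b, a, b, hwx.symm, hq, hr, fun n hn => ?_, ⟨a, ha, rfl, rfl, rfl⟩,
      ⟨b, hb, hab.symm, rfl, rfl⟩, ⟨w, hw, rfl, hwa, hwb⟩, ⟨v, hv, hvw, hvq, hvr⟩⟩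
    have h1 := hE n hn a ha
    have h2 := hE n hn b hb
    have h3 := hE n hn w hw
    have h4 := hE n hn v hv
    rw [← hab] at h2
    rw [hwa, hwb] at h3
    rw [hvw, hvq, hvr] at h4
    grind
  · left
    push Not at hv
    refine ⟨a, a, b, fun n hn => ?_⟩
    have h1 := hE n hn a ha
    have h2 := hE n hn b hb
    have h3 := hE n hn w hw
    have h4 := hv n hn
    rw [← hab] at h2
    rw [hwa, hwb] at h3
    grind

theorem majorityType_or_tetrahedralType
    (hE : ∀ a ∈ E, ∀ b ∈ E, (a : ZMod p) = b ∨ (a : ZMod q) = b ∨ (a : ZMod r) = b)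
    (hp : ¬ ∃ x : ZMod p, ∀ n ∈ E, (n : ZMod p) = x)
    (hq : ¬ ∃ x : ZMod q, ∀ n ∈ E, (n : ZMod q) = x)
    (hr : ¬ ∃ x : ZMod r, ∀ n ∈ E, (n : ZMod r) = x) :
    MajorityType E p q r ∨ TetrahedralType E p q r := by
  by_cases h1 : ∃ a ∈ E, ∃ b ∈ E, (a : ZMod q) ≠ b ∧ (a : ZMod r) ≠ b
  · exact majorityType_or_tetrahedralType_of_pair hE hp h1
  by_cases h2 : ∃ a ∈ E, ∃ b ∈ E, (a : ZMod p) ≠ b ∧ (a : ZMod r) ≠ b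
  · refine (majorityType_or_tetrahedralType_of_pair (fun a ha b hb => ?_) hq h2).imp
      MajorityType.swap_left TetrahedralType.swap_left
    have := hE a ha b hb
    tauto
  -- Elements that differ modulo `p` or `q` now agree modulo `r`. An element with a second residue
  -- modulo `r` would agree modulo `p` with both `a` and `b`.
  exfalso
  push Not at h1 h2 hp hq
  obtain ⟨a, ha, -⟩ := hp 0
  obtain ⟨b, hb, hba⟩ := hp a
  obtain ⟨c, hc, hca⟩ := hq a
  by_cases h3 : (b : ZMod q) = a
  · have e1 := h1 c hc b hb (fun h => hca (h.trans h3))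
    have e2 := h2 b hb a ha hba
    by_cases h5 : ∀ n ∈ E, (n : ZMod r) = a
    · exact hr ⟨_, h5⟩
    · push Not at h5
      obtain ⟨d, hd, hda⟩ := h5
      have f1 := h1 d hd
      have f2 := h2 d hd
      have g1 := f1 a ha
      have g2 := f1 c hc
      have g3 := f1 b hb
      have g4 := f2 a ha
      have g5 := f2 c hc
      have g6 := f2 b hb
      have g7 := h1 c hc a ha hca
      grind
  · by_cases h5 : ∀ n ∈ E, (n : ZMod r) = a
    · exact hr ⟨_, h5⟩
    · push Not at h5
      obtain ⟨d, hd, hda⟩ := h5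
      have e2 := h2 b hb a ha hba
      have f1 := h1 d hd
      have f2 := h2 d hd
      have g1 := f1 a ha
      have g3 := f1 b hb
      have g4 := f2 a ha
      have g6 := f2 b hb
      grind

end

/-! ### Tilings in terms of residues, and differences p in B -/

/-- The conditions on `A` and `B` that concern the prime `p` only. -/
structure PrimeConditions (p q r : ℕ) (A B : Finset ℕ) : Prop where
  left_not_const : ¬ ∃ x : ZMod p, ∀ n ∈ A, (n : ZMod p) = x
  right_not_const : ¬ ∃ x : ZMod p, ∀ n ∈ B, (n : ZMod p) = x
  diffPrime : DiffPrime A p q r → ¬ DiffPrime B p q r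
  diffPrimeSq : DiffPrimeSq A p q r → ¬ DiffPrimeSq B p q r

theorem PrimeConditions.swap {p q r : ℕ} {A B : Finset ℕ} (h : PrimeConditions p q r A B) :
    PrimeConditions p r q A B :=
  ⟨h.1, h.2, fun hA hB => h.3 hA.swap hB.swap, fun hA hB => h.4 hA.swap hB.swap⟩

/-- The properties of a tiling `A ⊕ B` of period `(p q r) ^ 2`, with `|A| = |B| = p q r` and
`1 ∉ Div(B)`, in terms of sets of natural numbers representing `A` and `B`. -/
structure TilingPair (p q r : ℕ) (A B : Finset ℕ) : Prop where
  hp : p.Prime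
  hq : q.Prime
  hr : r.Prime
  hpq : p ≠ q
  hqr : q ≠ r
  hpr : p ≠ r
  card_left : A.card = p * q * r
  card_right : B.card = p * q * r
  cyclotomic_dvd : ∀ s, s ∣ (p * q * r) ^ 2 → s ≠ 1 →
    cyclotomic s ℤ ∣ maskPoly A ∨ cyclotomic s ℤ ∣ maskPoly B
  agree : ∀ a ∈ B, ∀ b ∈ B, (a : ZMod p) = b ∨ (a : ZMod q) = b ∨ (a : ZMod r) = b
  first : PrimeConditions p q r A B
  second : PrimeConditions q p r A B
  third : PrimeConditions r p q A B

namespace TilingPair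

variable {p q r : ℕ} {A B : Finset ℕ}

theorem swap_left (T : TilingPair p q r A B) : TilingPair q p r A B where
  hp := T.hq
  hq := T.hp
  hr := T.hr
  hpq := T.hpq.symm
  hqr := T.hpr
  hpr := T.hqr
  card_left := by rw [T.card_left]; ring
  card_right := by rw [T.card_right]; ring
  cyclotomic_dvd := by rw [mul_comm q p]; exact T.cyclotomic_dvd
  agree := fun a ha b hb => by have := T.agree a ha b hb; tauto
  first := T.second
  second := T.first
  third := T.third.swap

theorem swap_right (T : TilingPair p q r A B) : TilingPair p r q A B where
  hp := T.hp
  hq := T.hr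
  hr := T.hq
  hpq := T.hpr
  hqr := T.hqr.symm
  hpr := T.hpq
  card_left := by rw [T.card_left]; ring
  card_right := by rw [T.card_right]; ring
  cyclotomic_dvd := by rw [mul_right_comm]; exact T.cyclotomic_dvd
  agree := fun a ha b hb => by have := T.agree a ha b hb; tauto
  first := T.first.swap
  second := T.third
  third := T.second

theorem left_of_not_right (T : TilingPair p q r A B) {s : ℕ} (hs : s ∣ (p * q * r) ^ 2)
    (hps : p ∣ s) (h : ¬ cyclotomic s ℤ ∣ maskPoly B) : cyclotomic s ℤ ∣ maskPoly A :=
  (T.cyclotomic_dvd s hs (by rintro rfl; exact T.hp.one_lt.ne' (Nat.dvd_one.1 hps))).resolve_right h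

theorem right_of_not_left (T : TilingPair p q r A B) {s : ℕ} (hs : s ∣ (p * q * r) ^ 2)
    (hps : p ∣ s) (h : ¬ cyclotomic s ℤ ∣ maskPoly A) : cyclotomic s ℤ ∣ maskPoly B :=
  (T.cyclotomic_dvd s hs (by rintro rfl; exact T.hp.one_lt.ne' (Nat.dvd_one.1 hps))).resolve_left h

theorem right_sq (T : TilingPair p q r A B) (h : cyclotomic p ℤ ∣ maskPoly A) :
    cyclotomic (p ^ 2) ℤ ∣ maskPoly B :=
  T.right_of_not_left ⟨(q * r) ^ 2, by ring⟩ (dvd_pow_self p two_ne_zero) fun h' =>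
    not_cyclotomic_and_sq T.hp T.hq T.hr T.hpq T.hpr T.card_left ⟨h, h'⟩

theorem left_sq (T : TilingPair p q r A B) (h : cyclotomic p ℤ ∣ maskPoly B) :
    cyclotomic (p ^ 2) ℤ ∣ maskPoly A :=
  T.left_of_not_right ⟨(q * r) ^ 2, by ring⟩ (dvd_pow_self p two_ne_zero) fun h' =>
    not_cyclotomic_and_sq T.hp T.hq T.hr T.hpq T.hpr T.card_right ⟨h, h'⟩

/-- A class modulo $p$ other than `x₀` meets only the center of the cross, while `x₀` carries both
arms. So no mixed polynomial at $p$ divides $B$; all of them pass to $A$ and confine it to one class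
modulo $p$. -/
theorem not_cyclotomic_right_of_majority (T : TilingPair p q r A B) (hB : MajorityType B p q r) :
    ¬ cyclotomic p ℤ ∣ maskPoly B := by
  intro h
  obtain ⟨x₀, y₀, z₀, hmaj⟩ := hB
  have := Fact.mk T.hp.one_lt
  obtain ⟨x', hx'⟩ := exists_ne x₀
  obtain ⟨t, ht⟩ := exists_eq_add_pow_zero T.hp x₀ x'
  have hY := T.second.right_not_const
  have hZ := T.third.right_not_const
  push Not at hY hZ
  obtain ⟨b, hb, hby⟩ := hY y₀
  obtain ⟨c, hc, hcz⟩ := hZ z₀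
  have hbx : (b : ZMod p) = x₀ := by have := hmaj b hb; tauto
  have hcx : (c : ZMod p) = x₀ := by have := hmaj c hc; tauto
  have hcross : ∀ n ∈ B, (n : ZMod p) = x₀ → (n : ZMod q) = y₀ ∨ (n : ZMod r) = z₀ :=
    fun n hn _ => by have := hmaj n hn; tauto
  have hcen : ∀ n ∈ B, (n : ZMod p) = x' → (n : ZMod q) = y₀ ∧ (n : ZMod r) = z₀ :=
    fun n hn hnx => by have := hmaj n hn; rw [hnx] at this; tauto
  obtain ⟨h1, h2⟩ := not_cyclotomic_of_center T.hp T.hq T.hr T.hpq T.hqr T.hpr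
    (a := 0) (by ring) h ht hcross hcen hb hbx hby
  obtain ⟨h3, -⟩ := not_cyclotomic_of_center T.hp T.hr T.hq T.hpr T.hqr.symm T.hpq
    (a := 0) (by ring) h ht (fun n hn hx => (hcross n hn hx).symm)
    (fun n hn hx => (hcen n hn hx).symm) hc hcx hcz
  exact T.first.left_not_const (forall_natCast_eq_of_cyclotomic_sq T.hp T.hq T.hr T.hpq T.hqr T.hpr
    T.card_left (T.left_sq h)
    (T.left_of_not_right ⟨p * q * r ^ 2, by ring⟩ (dvd_mul_right _ _) h1)
    (T.left_of_not_right ⟨p * q ^ 2 * r, by ring⟩ (dvd_mul_right _ _) h3)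
    (T.left_of_not_right ⟨p * q * r, by ring⟩ (Dvd.intro _ (mul_assoc p q r).symm) h2))

/-- `A` meets each residue class modulo `p q r` exactly once, and its elements congruent
modulo `p` are congruent modulo `p ^ 2`. -/
def _root_.UniformOver (A : Finset ℕ) (p q r : ℕ) : Prop :=
  ∀ x : ZMod p, ∃ u : ZMod (p ^ 2), sqReduction p u = x ∧
    (∀ y z, count₃ A (p ^ 2) q r u y z = 1) ∧ ∀ a ∈ A, (a : ZMod p) = x → (a : ZMod (p ^ 2)) = u

theorem _root_.UniformOver.exists_mem (h : UniformOver A p q r) (x : ZMod p) (y : ZMod q)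
    (z : ZMod r) : ∃ a ∈ A, (a : ZMod p) = x ∧ (a : ZMod q) = y ∧ (a : ZMod r) = z := by
  obtain ⟨u, rfl, hu, -⟩ := h x
  obtain ⟨a, ha, hau, hay, haz⟩ := count₃_pos_iff.1 (show 0 < count₃ A (p ^ 2) q r u y z by
    rw [hu]; exact one_pos)
  exact ⟨a, ha, by rw [← hau, map_natCast], hay, haz⟩

theorem _root_.UniformOver.eq (h : UniformOver A p q r) {a b : ℕ} (ha : a ∈ A) (hb : b ∈ A)
    (hp : (a : ZMod p) = b) (hq : (a : ZMod q) = b) (hr : (a : ZMod r) = b) : a = b := by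
  obtain ⟨u, -, hu, hA⟩ := h a
  have h1 := (hu (a : ZMod q) (a : ZMod r)).le
  exact Finset.card_le_one.1 h1 a (Finset.mem_filter.2 ⟨ha, hA a ha rfl, rfl, rfl⟩) b
    (Finset.mem_filter.2 ⟨hb, hA b hb hp.symm, hq.symm, hr.symm⟩)

theorem _root_.UniformOver.diffPrimeSq (h : UniformOver A p q r) (hq : q.Prime) (hr : r.Prime) :
    DiffPrimeSq A p q r := by
  have := Fact.mk hq.one_lt
  have := Fact.mk hr.one_lt
  obtain ⟨u, -, hu, -⟩ := h 0
  obtain ⟨a, ha, hau, hay, haz⟩ := count₃_pos_iff.1 (show 0 < count₃ A (p ^ 2) q r u 0 0 by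
    rw [hu]; exact one_pos)
  obtain ⟨b, hb, hbu, hby, hbz⟩ := count₃_pos_iff.1 (show 0 < count₃ A (p ^ 2) q r u 1 1 by
    rw [hu]; exact one_pos)
  refine ⟨a, ha, b, hb, hau.trans hbu.symm, ?_, ?_⟩
  · rw [hay, hby]; exact zero_ne_one
  · rw [haz, hbz]; exact zero_ne_one

theorem uniformOver (T : TilingPair p q r A B) (h : cyclotomic p ℤ ∣ maskPoly A)
    (h₁ : ¬ cyclotomic (p ^ 2 * q) ℤ ∣ maskPoly B) (h₂ : ¬ cyclotomic (p ^ 2 * r) ℤ ∣ maskPoly B)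
    (h₃ : ¬ cyclotomic (p ^ 2 * q * r) ℤ ∣ maskPoly B) : UniformOver A p q r :=
  have hd : p ∣ p ^ 2 := dvd_pow_self p two_ne_zero
  exists_full_class T.hp T.hq T.hr T.hpq T.hqr T.hpr T.card_left h
    (T.left_of_not_right ⟨q * r ^ 2, by ring⟩ (hd.mul_right _) h₁)
    (T.left_of_not_right ⟨q ^ 2 * r, by ring⟩ (hd.mul_right _) h₂)
    (T.left_of_not_right ⟨q * r, by ring⟩ ((hd.mul_right _).mul_right _) h₃)

/-- Otherwise both arms lie in a single class modulo $p^2$, and another lift of that residue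
contains only the center. The mixed polynomials at $p^2$ then pass to $A$, and both sets acquire a
difference of type $p^2$. -/
theorem diffPrime_of_majority (T : TilingPair p q r A B) (hB : MajorityType B p q r)
    (h : cyclotomic p ℤ ∣ maskPoly A) : DiffPrime B p q r := by
  by_contra hcon
  have hsq := T.right_sq h
  obtain ⟨x₀, y₀, z₀, hmaj⟩ := hB
  have hY := T.second.right_not_const
  have hZ := T.third.right_not_const
  push Not at hY hZ
  obtain ⟨b, hb, hby⟩ := hY y₀
  obtain ⟨c, hc, hcz⟩ := hZ z₀
  have hcross : ∀ n ∈ B, (n : ZMod q) = y₀ ∨ (n : ZMod r) = z₀ :=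
    fun n hn => by have := hmaj n hn; tauto
  have hxy : ∀ n ∈ B, (n : ZMod q) ≠ y₀ → (n : ZMod p) = x₀ :=
    fun n hn _ => by have := hmaj n hn; tauto
  have hxz : ∀ n ∈ B, (n : ZMod r) ≠ z₀ → (n : ZMod p) = x₀ :=
    fun n hn _ => by have := hmaj n hn; tauto
  have harms : ∀ n ∈ B, ∀ n' ∈ B, (n : ZMod q) ≠ y₀ → (n' : ZMod r) ≠ z₀ →
      (n : ZMod (p ^ 2)) = n' ∧ (n : ZMod q) ≠ n' ∧ (n : ZMod r) ≠ n' := by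
    intro n hn n' hn' h1 h2
    have e1 := (hcross n hn).resolve_left h1
    have e2 := (hcross n' hn').resolve_right h2
    have f1 : (n : ZMod q) ≠ n' := by rwa [e2]
    have f2 : (n : ZMod r) ≠ n' := by rw [e1]; exact h2.symm
    refine ⟨?_, f1, f2⟩
    by_contra hne
    exact hcon ⟨n, hn, n', hn', (hxy n hn h1).trans (hxz n' hn' h2).symm, hne, f1, f2⟩
  obtain ⟨u', hne, hu'⟩ := exists_ne_sqReduction_eq T.hp (b : ZMod (p ^ 2))
  obtain ⟨t, ht⟩ := exists_eq_add_of_sqReduction_eq T.hp hu'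
  have hbc := (harms b hb c hc hby hcz).1
  have hcen : ∀ n ∈ B, (n : ZMod (p ^ 2)) = u' → (n : ZMod q) = y₀ ∧ (n : ZMod r) = z₀ := by
    intro n hn hnu
    constructor
    · by_contra hny
      exact hne (hnu.symm.trans ((harms n hn c hc hny hcz).1.trans hbc.symm))
    · by_contra hnz
      exact hne (hnu.symm.trans (harms b hb n hn hby hnz).1.symm)
  obtain ⟨h1, h2⟩ := not_cyclotomic_of_center T.hp T.hq T.hr T.hpq T.hqr T.hpr
    (m := p ^ 2) (a := 1) rfl hsq ht (fun n hn _ => hcross n hn) hcen hb rfl hby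
  obtain ⟨h3, -⟩ := not_cyclotomic_of_center T.hp T.hr T.hq T.hpr T.hqr.symm T.hpq
    (m := p ^ 2) (a := 1) rfl hsq ht (fun n hn _ => (hcross n hn).symm)
    (fun n hn hx => (hcen n hn hx).symm) hc hbc.symm hcz
  exact T.first.diffPrimeSq ((T.uniformOver h h1 h3 h2).diffPrimeSq T.hq T.hr)
    ⟨b, hb, c, hc, harms b hb c hc hby hcz⟩

/-- If the two vertices over `x₀` lie in one class modulo $p^2$, then $\Phi_{p^2}$ puts a further
element over `x₀` in another lift. It shares a vertex with one of them and forms the required pair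
with the other. -/
theorem diffPrime_of_tetrahedral (T : TilingPair p q r A B) (hB : TetrahedralType B p q r)
    (h : cyclotomic p ℤ ∣ maskPoly A) : DiffPrime B p q r := by
  have hsq := T.right_sq h
  obtain ⟨x₀, x₁, y₀, y₁, z₀, z₁, hx, hy, hz, hmem, ⟨b, hb, hbx, hby, hbz⟩,
    ⟨c, hc, hcx, hcy, hcz⟩, -⟩ := hB
  by_contra hcon
  have hbc : (b : ZMod (p ^ 2)) = c := by
    by_contra hne
    exact hcon ⟨b, hb, c, hc, hbx.trans hcx.symm, hne, by rwa [hby, hcy], by rwa [hbz, hcz]⟩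
  obtain ⟨u', hne, hu'⟩ := exists_ne_sqReduction_eq T.hp (b : ZMod (p ^ 2))
  have hpos : 0 < count₁ B (p ^ 2) b := count₁_pos_iff.2 ⟨b, hb, rfl⟩
  rw [count₁_sq_eq T.hp hsq hu', count₁_pos_iff] at hpos
  obtain ⟨n, hn, rfl⟩ := hpos
  rw [map_natCast, map_natCast] at hu'
  rcases hmem n hn with ⟨-, h1, h2⟩ | ⟨-, h1, h2⟩ | ⟨h0, -⟩ | ⟨h0, -⟩
  · exact hcon ⟨n, hn, c, hc, hu'.symm.trans (hbx.trans hcx.symm), hbc ▸ hne, by rwa [h1, hcy],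
      by rwa [h2, hcz]⟩
  · exact hcon ⟨n, hn, b, hb, hu'.symm, hne, by rw [h1, hby]; exact hy.symm,
      by rw [h2, hbz]; exact hz.symm⟩
  · exact hx (hbx.symm.trans (hu'.trans h0))
  · exact hx (hbx.symm.trans (hu'.trans h0))

theorem diffPrime_right (T : TilingPair p q r A B) (h : cyclotomic p ℤ ∣ maskPoly A) :
    DiffPrime B p q r :=
  (majorityType_or_tetrahedralType T.agree T.first.right_not_const T.second.right_not_const
    T.third.right_not_const).elim (fun hB => T.diffPrime_of_majority hB h)
    fun hB => T.diffPrime_of_tetrahedral hB h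

end TilingPair

/-! ### If B has no difference p², then A is uniform -/

theorem ZMod.exists_ne_ne {n : ℕ} (hn : 2 < n) (x y : ZMod n) : ∃ z, z ≠ x ∧ z ≠ y := by
  have : NeZero n := ⟨by omega⟩
  have hcard : ({x, y} : Finset (ZMod n)).card < (Finset.univ : Finset (ZMod n)).card := by
    refine Finset.card_le_two.trans_lt ?_
    rwa [Finset.card_univ, ZMod.card]
  obtain ⟨z, -, hz⟩ := Finset.exists_mem_notMem_of_card_lt_card hcard
  exact ⟨z, by simpa using hz⟩

namespace TilingPair

variable {p q r : ℕ} {A B : Finset ℕ}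

/-- By `hcon` no layer meets both arms. The arm relations then make the cell of `b` in each layer
over `x₀` have $0$ or $r$ elements. Hence $Nr$ elements of $B$ are congruent to `b` modulo $q$, with
$1\le N\le p<q$, whereas $\Phi_{q^2}\mid B$ requires $q\mid Nr$. -/
theorem not_cyclotomic_sq_three_of_majority (T : TilingPair p q r A B) (hlt : p < q)
    (hB : MajorityType B p q r) (h : cyclotomic p ℤ ∣ maskPoly A)
    (hAq : cyclotomic q ℤ ∣ maskPoly A) (hcon : ¬ DiffPrimeSq B p q r) :
    ¬ cyclotomic (p ^ 2 * q * r) ℤ ∣ maskPoly B := by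
  classical
  intro h₃
  have hp := T.hp
  have hq := T.hq
  have hr := T.hr
  have : NeZero (p ^ 2) := ⟨pow_ne_zero _ hp.ne_zero⟩
  have : NeZero q := ⟨hq.ne_zero⟩
  have : NeZero r := ⟨hr.ne_zero⟩
  have hsq := T.right_sq h
  have hsq' := T.swap_left.right_sq hAq
  obtain ⟨x₀, y₀, z₀, hmaj⟩ := hB
  have hY := T.second.right_not_const
  have hZ := T.third.right_not_const
  push Not at hY hZ
  obtain ⟨b, hb, hby⟩ := hY y₀
  obtain ⟨c, hc, hcz⟩ := hZ z₀
  have hcross : ∀ n ∈ B, (n : ZMod q) = y₀ ∨ (n : ZMod r) = z₀ :=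
    fun n hn => by have := hmaj n hn; tauto
  have hbx : (b : ZMod p) = x₀ := by have := hmaj b hb; tauto
  have hcx : (c : ZMod p) = x₀ := by have := hmaj c hc; tauto
  have harms : ∀ n ∈ B, ∀ n' ∈ B, (n : ZMod q) ≠ y₀ → (n' : ZMod r) ≠ z₀ →
      (n : ZMod (p ^ 2)) ≠ n' := by
    intro n hn n' hn' h1 h2 he
    refine hcon ⟨n, hn, n', hn', he, ?_, ?_⟩
    · rwa [(hcross n' hn').resolve_right h2]
    · rw [(hcross n hn).resolve_left h1]; exact h2.symm
  have hY2 : ∀ y, y ≠ y₀ → count₃ B (p ^ 2) q r c y z₀ = 0 := fun y hy =>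
    count₃_eq_zero fun n hn hnc hny _ => harms n hn c hc (hny ▸ hy) hcz hnc
  have hZ1 : ∀ z, z ≠ z₀ → count₃ B (p ^ 2) q r b y₀ z = 0 := fun z hz =>
    count₃_eq_zero fun n hn hnb _ hnz => harms b hb n hn hby (hnz ▸ hz) hnb.symm
  have hk : ∀ u : ZMod (p ^ 2), sqReduction p u = x₀ → ∃ k : ℤ,
      (∀ y ≠ y₀, (count₃ B (p ^ 2) q r u y z₀ : ℤ) = r * k) ∧ ∀ z ≠ z₀,
        (count₃ B (p ^ 2) q r u y₀ z - count₃ B (p ^ 2) q r c y₀ z : ℤ) = -(q * k) := by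
    intro u hu
    obtain ⟨t, ht⟩ := exists_eq_add_of_sqReduction_eq hp (u := (c : ZMod (p ^ 2))) (u' := u)
      (by rw [map_natCast, hcx, hu])
    obtain ⟨k, hk1, hk2⟩ := exists_arms_of_cross hp hq hr T.hpq T.hqr T.hpr (m := p ^ 2) (a := 1)
      rfl hsq h₃ ht (y₀ := y₀) (z₀ := z₀) fun n hn _ => hcross n hn
    refine ⟨k, fun y hy => ?_, hk2⟩
    rw [← hk1 y hy, hY2 y hy]
    simp
  obtain ⟨k₁, hk1, hk1'⟩ := hk b (by rw [map_natCast, hbx])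
  have hbpos : 0 < count₃ B (p ^ 2) q r b b z₀ := count₃_pos_iff.2
    ⟨b, hb, rfl, rfl, (hcross b hb).resolve_left hby⟩
  have hr0 : (0 : ℤ) < r := by exact_mod_cast hr.pos
  have hq0 : (0 : ℤ) < q := by exact_mod_cast hq.pos
  have hq3 : 3 ≤ q := by have := hp.two_le; omega
  have hk1pos : 0 < k₁ := by
    have := hk1 b hby
    refine pos_of_mul_pos_right (a := (r : ℤ)) ?_ hr0.le
    omega
  -- The layer of `b` has at most $qr$ elements and its arm has $(q-1)rk_1$; as $q\ge 3$, this
  -- excludes $k_1\ge 2$.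
  have hk1le : k₁ ≤ 1 := by
    have e1 : count₁ B (p ^ 2) b ≤ q * r := by
      have e2 := count₁_eq_mul_count₁_sq hp hsq (b : ZMod (p ^ 2))
      have e3 : count₁ B p (sqReduction p (b : ZMod (p ^ 2))) ≤ p * q * r :=
        T.card_right ▸ Finset.card_filter_le _ _
      refine Nat.le_of_mul_le_mul_left ?_ hp.pos
      rw [← e2, ← mul_assoc]
      exact e3
    have e2 : ∑ y ∈ Finset.univ.erase y₀, count₃ B (p ^ 2) q r b y z₀ ≤ count₁ B (p ^ 2) b := by
      rw [count₁_eq_sum_count₃ B (p ^ 2) q r]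
      refine (Finset.sum_le_sum fun y _ => ?_).trans
        (Finset.sum_le_sum_of_subset (Finset.erase_subset _ _))
      exact Finset.single_le_sum (f := fun z => count₃ B (p ^ 2) q r b y z)
        (fun _ _ => Nat.zero_le _) (Finset.mem_univ z₀)
    have e3 : ((∑ y ∈ Finset.univ.erase y₀, count₃ B (p ^ 2) q r b y z₀ : ℕ) : ℤ) =
        (q - 1) * (r * k₁) := by
      push_cast
      rw [Finset.sum_congr rfl fun y hy => hk1 y (Finset.ne_of_mem_erase hy), Finset.sum_const,
        Finset.card_erase_of_mem (Finset.mem_univ _), Finset.card_univ, ZMod.card, nsmul_eq_mul,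
        Nat.cast_sub hq.one_le, Nat.cast_one]
    have e4 : ((q : ℤ) - 1) * (r * k₁) ≤ q * r := by
      rw [← e3]; exact_mod_cast e2.trans e1
    have e5 : ((q : ℤ) - 1) * k₁ ≤ q := le_of_mul_le_mul_right (by linarith) hr0
    by_contra hgt
    have : (3 : ℤ) ≤ q := by exact_mod_cast hq3
    nlinarith
  have hk1one : k₁ = 1 := by omega
  subst hk1one
  have hval : ∀ u : ZMod (p ^ 2), sqReduction p u = x₀ → count₃ B (p ^ 2) q r u b z₀ ≠ 0 →
      count₃ B (p ^ 2) q r u b z₀ = r := by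
    intro u hu hne
    obtain ⟨k, e1, e2⟩ := hk u hu
    have := Fact.mk hr.one_lt
    obtain ⟨z₁, hz₁⟩ := exists_ne z₀
    have f1 := e1 b hby
    have f2 := e2 z₁ hz₁
    have f3 := hk1' z₁ hz₁
    rw [hZ1 z₁ hz₁] at f3
    have hkpos : 0 < k := by
      refine pos_of_mul_pos_right (a := (r : ℤ)) ?_ hr0.le
      omega
    -- The other arm has $q$ elements per cell in the layer of `c`, hence $q(1-k)$ in the layer `u`.
    have hkle : 0 ≤ (q : ℤ) * (1 - k) := by
      have : (q : ℤ) * (1 - k) = count₃ B (p ^ 2) q r u y₀ z₁ := by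
        push_cast at f3
        linarith
      rw [this]
      exact Int.natCast_nonneg _
    have hkle' := nonneg_of_mul_nonneg_right hkle hq0
    have : k = 1 := by omega
    subst this
    rw [mul_one] at f1
    exact_mod_cast f1
  set F : Finset (ZMod (p ^ 2)) := Finset.univ.filter fun u => sqReduction p u = x₀ with hF
  have hsum : count₁ B q b = ∑ u ∈ F, count₃ B (p ^ 2) q r u b z₀ := by
    unfold count₁ count₃
    rw [Finset.card_eq_sum_card_fiberwise (s := B.filter fun n : ℕ => (n : ZMod q) = b)
      (f := fun n : ℕ => (n : ZMod (p ^ 2))) (t := F)]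
    · refine Finset.sum_congr rfl fun u _ => ?_
      rw [Finset.filter_filter]
      congr 1
      refine Finset.filter_congr fun n hn => ⟨fun h' => ⟨h'.2, h'.1, ?_⟩, fun h' => ⟨h'.2.1, h'.1⟩⟩
      exact (hcross n hn).resolve_left (h'.1 ▸ hby)
    · intro n hn
      rw [Finset.mem_coe, Finset.mem_filter] at hn
      rw [Finset.mem_coe, hF, Finset.mem_filter, map_natCast]
      refine ⟨Finset.mem_univ _, ?_⟩
      have h1 := hmaj n hn.1
      have h2 : (n : ZMod q) ≠ y₀ := hn.2 ▸ hby
      tauto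
  have hsum2 : count₁ B q b = (F.filter fun u => count₃ B (p ^ 2) q r u b z₀ ≠ 0).card * r := by
    rw [hsum, ← Finset.sum_filter_ne_zero, Finset.sum_congr rfl fun u hu =>
      hval u (Finset.mem_filter.1 (Finset.mem_filter.1 hu).1).2 (Finset.mem_filter.1 hu).2,
      Finset.sum_const, smul_eq_mul]
  have hdvd := dvd_count₁ hq hsq' (b : ZMod q)
  rw [hsum2, hq.dvd_mul, Nat.prime_dvd_prime_iff_eq hq hr] at hdvd
  have hle : (F.filter fun u => count₃ B (p ^ 2) q r u b z₀ ≠ 0).card ≤ p :=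
    (Finset.card_filter_le _ _).trans (card_filter_sqReduction hp x₀).le
  have hpos : 0 < (F.filter fun u => count₃ B (p ^ 2) q r u b z₀ ≠ 0).card :=
    Finset.card_pos.2 ⟨(b : ZMod (p ^ 2)), Finset.mem_filter.2
      ⟨Finset.mem_filter.2 ⟨Finset.mem_univ _, by rw [map_natCast, hbx]⟩, hbpos.ne'⟩⟩
  have := Nat.le_of_dvd hpos (hdvd.resolve_right T.hqr)
  omega

theorem uniformOver_of_majority (T : TilingPair p q r A B) (hlt : p < q)
    (hB : MajorityType B p q r) (h : cyclotomic p ℤ ∣ maskPoly A)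
    (hAq : cyclotomic q ℤ ∣ maskPoly A) (hcon : ¬ DiffPrimeSq B p q r) : UniformOver A p q r := by
  have h₃ := T.not_cyclotomic_sq_three_of_majority hlt hB h hAq hcon
  have hsq := T.right_sq h
  obtain ⟨x₀, y₀, z₀, hmaj⟩ := hB
  have hY := T.second.right_not_const
  have hZ := T.third.right_not_const
  push Not at hY hZ
  obtain ⟨b, hb, hby⟩ := hY y₀
  obtain ⟨c, hc, hcz⟩ := hZ z₀
  have hb' : (b : ZMod p) = x₀ ∧ (b : ZMod r) = z₀ := by have := hmaj b hb; tauto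
  have hc' : (c : ZMod p) = x₀ ∧ (c : ZMod q) = y₀ := by have := hmaj c hc; tauto
  refine T.uniformOver h (fun h' => hcon ?_) (fun h' => hcon ?_) h₃
  · refine (diffPrime_and_diffPrimeSq_of_cyclotomic T.hp T.hq T.hpq hsq h' hb hc
      (hb'.1.trans hc'.1.symm) (by rwa [hc'.2]) fun n hn _ hnq hnr => ?_).2
    have := hmaj n hn
    rw [hnq, hnr] at this
    tauto
  · refine (diffPrime_and_diffPrimeSq_of_cyclotomic T.hp T.hr T.hpr hsq h' hc hb
      (hc'.1.trans hb'.1.symm) (by rwa [hb'.2]) fun n hn _ hnr hnq => ?_).2.swap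
    have := hmaj n hn
    rw [hnq, hnr] at this
    tauto

/-- With a residue `y₂` that $B$ does not use, seven terms of the cuboid relation vanish; the one
left is the nonempty cell of `b`. -/
theorem not_cyclotomic_sq_three_of_tetrahedral (T : TilingPair p q r A B) (hq2 : 2 < q)
    (hB : TetrahedralType B p q r) (hcon : ¬ DiffPrimeSq B p q r) :
    ¬ cyclotomic (p ^ 2 * q * r) ℤ ∣ maskPoly B := by
  intro h₃
  obtain ⟨x₀, x₁, y₀, y₁, z₀, z₁, hx, hy, hz, hmem, ⟨b, hb, hbx, hby, hbz⟩,
    ⟨c, hc, hcx, hcy, hcz⟩, -⟩ := hB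
  obtain ⟨y₂, h20, h21⟩ := ZMod.exists_ne_ne hq2 y₀ y₁
  obtain ⟨t, ht⟩ := exists_eq_add_of_sqReduction_eq T.hp (u := (b : ZMod (p ^ 2)))
    (u' := (c : ZMod (p ^ 2))) (by rw [map_natCast, map_natCast, hbx, hcx])
  have key := count₃_add T.hp T.hq T.hr T.hpq T.hqr T.hpr (m := p ^ 2) (a := 1) rfl h₃ ht
    y₀ y₂ z₀ z₁
  have hzero : ∀ u : ZMod (p ^ 2), ∀ z, count₃ B (p ^ 2) q r u y₂ z = 0 := by
    intro u z
    refine count₃_eq_zero fun n hn _ hny _ => ?_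
    have := hmem n hn
    rw [hny] at this
    tauto
  have hzero' : ∀ u : ZMod (p ^ 2), sqReduction p u = x₀ →
      count₃ B (p ^ 2) q r u y₀ z₁ = 0 := by
    intro u hu
    refine count₃_eq_zero fun n hn hnu hny hnz => ?_
    have h1 := hmem n hn
    have h2 : (n : ZMod p) = x₀ := by rw [← hu, ← hnu, map_natCast]
    rw [h2, hny, hnz] at h1
    tauto
  rw [hzero, hzero, hzero, hzero, hzero' b (by rw [map_natCast, hbx]),
    hzero' c (by rw [map_natCast, hcx]), count₃_eq_zero (u := (c : ZMod (p ^ 2)))] at key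
  · have hpos : 0 < count₃ B (p ^ 2) q r b y₀ z₀ := count₃_pos_iff.2 ⟨b, hb, rfl, hby, hbz⟩
    omega
  · intro n hn hnc hny hnz
    exact hcon ⟨n, hn, c, hc, hnc, by rwa [hny, hcy], by rwa [hnz, hcz]⟩

theorem uniformOver_of_tetrahedral (T : TilingPair p q r A B)
    (hB : TetrahedralType B p q r) (h : cyclotomic p ℤ ∣ maskPoly A)
    (hcon : ¬ DiffPrimeSq B p q r) : UniformOver A p q r := by
  have h₃ : ¬ cyclotomic (p ^ 2 * q * r) ℤ ∣ maskPoly B := by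
    -- At most one of the distinct primes `q`, `r` equals 2, and their roles can be exchanged.
    by_cases hq2 : 2 < q
    · exact T.not_cyclotomic_sq_three_of_tetrahedral hq2 hB hcon
    · rw [mul_right_comm]
      have h1 := T.hq.two_le
      have h2 := T.hr.two_le
      have h3 := T.hqr
      exact T.swap_right.not_cyclotomic_sq_three_of_tetrahedral (by omega) hB.swap_right
        fun h' => hcon h'.swap
  have hsq := T.right_sq h
  obtain ⟨x₀, x₁, y₀, y₁, z₀, z₁, hx, hy, hz, hmem, ⟨b, hb, hbx, hby, hbz⟩,
    ⟨c, hc, hcx, hcy, hcz⟩, -⟩ := hB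
  refine T.uniformOver h (fun h' => hcon ?_) (fun h' => hcon ?_) h₃
  · refine (diffPrime_and_diffPrimeSq_of_cyclotomic T.hp T.hq T.hpq hsq h' hb hc
      (hbx.trans hcx.symm) (by rwa [hby, hcy]) fun n hn hnp hnq hnr => ?_).2
    have := hmem n hn
    rw [hnp, hnq, hnr, hbx, hby, hcz] at this
    tauto
  · refine (diffPrime_and_diffPrimeSq_of_cyclotomic T.hp T.hr T.hpr hsq h' hb hc
      (hbx.trans hcx.symm) (by rwa [hbz, hcz]) fun n hn hnp hnr hnq => ?_).2.swap
    have := hmem n hn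
    rw [hnp, hnq, hnr, hbx, hbz, hcy] at this
    tauto

/-! ### Excluding Φ_p ∣ B in the tetrahedral case -/

theorem eq_two_of_tetrahedral (T : TilingPair p q r A B) (hB : TetrahedralType B p q r)
    (h : cyclotomic p ℤ ∣ maskPoly B) : p = 2 := by
  obtain ⟨x₀, x₁, y₀, y₁, z₀, z₁, hx, hy, hz, hmem, -⟩ := hB
  by_contra hne
  obtain ⟨x₂, h20, h21⟩ := ZMod.exists_ne_ne (lt_of_le_of_ne T.hp.two_le (Ne.symm hne)) x₀ x₁
  have hpos : 0 < count₁ B p x₂ := by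
    rw [count₁_eq_of_card T.hp T.card_right h]
    exact Nat.mul_pos T.hq.pos T.hr.pos
  obtain ⟨n, hn, rfl⟩ := count₁_pos_iff.1 hpos
  have := hmem n hn
  tauto

/-- In the tetrahedral case with `Φ_p ∣ B`, two elements of `A` congruent modulo `q` are
congruent modulo `p` or `r`. -/
theorem agree_left_of_tetrahedral (T : TilingPair p q r A B) (hB : TetrahedralType B p q r)
    (h : cyclotomic p ℤ ∣ maskPoly B) (hAq : cyclotomic q ℤ ∣ maskPoly A) {a b : ℕ}
    (ha : a ∈ A) (hb : b ∈ A) (hab : (a : ZMod q) = b) :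
    (a : ZMod p) = b ∨ (a : ZMod r) = b := by
  by_contra hn
  push Not at hn
  have h1 := T.swap_left.diffPrime_of_tetrahedral hB.swap_left hAq
  -- Otherwise $A$ is a complete residue system modulo $pqr$, with $qr$ elements in a class modulo
  -- $p$, against $\Phi_{p^2}\mid A$.
  have h2 : DiffPrimeSq B q p r := by
    by_contra hcon
    have hU := T.swap_left.uniformOver_of_tetrahedral hB.swap_left hAq hcon
    have : NeZero q := ⟨T.hq.ne_zero⟩
    have : NeZero r := ⟨T.hr.ne_zero⟩
    have hone : ∀ y z, count₃ A p q r 0 y z = 1 := by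
      intro y z
      apply le_antisymm
      · refine Finset.card_le_one.2 fun n hn n' hn' => ?_
        rw [Finset.mem_filter] at hn hn'
        exact hU.eq hn.1 hn'.1 (hn.2.2.1.trans hn'.2.2.1.symm) (hn.2.1.trans hn'.2.1.symm)
          (hn.2.2.2.trans hn'.2.2.2.symm)
      · rw [Nat.succ_le_iff, count₃_pos_iff]
        obtain ⟨n, hn, h1, h2, h3⟩ := hU.exists_mem y 0 z
        exact ⟨n, hn, h2, h1, h3⟩
    have hd := dvd_count₁ T.hp (T.left_sq h) 0
    rw [count₁_eq_sum_count₃ A p q r] at hd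
    simp only [hone, Finset.sum_const, Finset.card_univ, ZMod.card, smul_eq_mul, mul_one] at hd
    exact not_dvd_mul_primes T.hp T.hq T.hr T.hpq T.hpr hd
  rcases diffPrime_or_diffPrimeSq ha hb hab hn.1 hn.2 with h' | h'
  · exact T.second.diffPrime h' h1
  · exact T.second.diffPrimeSq h' h2

/-- Since $q,r>2$, there are residues `y₂`, `z₂` unused by $B$, so $\Phi_{qr}\nmid B$. Then $\Phi_r$
gives $A$ an element over `z`, and $\Phi_q$, $\Phi_{qr}$ move it to `y`. -/
theorem exists_mem_left_of_tetrahedral (T : TilingPair p q r A B)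
    (hB : TetrahedralType B p q r) (hp2 : p = 2) (hAq : cyclotomic q ℤ ∣ maskPoly A)
    (hAr : cyclotomic r ℤ ∣ maskPoly A) (y : ZMod q) (z : ZMod r) :
    ∃ a ∈ A, (a : ZMod q) = y ∧ (a : ZMod r) = z := by
  have h2q : 2 < q := lt_of_le_of_ne T.hq.two_le (hp2 ▸ T.hpq)
  have h2r : 2 < r := lt_of_le_of_ne T.hr.two_le (hp2 ▸ T.hpr)
  have hAqr : cyclotomic (q * r) ℤ ∣ maskPoly A := by
    refine T.swap_left.left_of_not_right ⟨p ^ 2 * q * r, by ring⟩ (dvd_mul_right _ _) fun h' => ?_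
    obtain ⟨x₀, x₁, y₀, y₁, z₀, z₁, hx, hy, hz, hmem, ⟨b, hb, hbx, hby, hbz⟩, -⟩ := hB
    obtain ⟨y₂, hy20, hy21⟩ := ZMod.exists_ne_ne h2q y₀ y₁
    obtain ⟨z₂, hz20, hz21⟩ := ZMod.exists_ne_ne h2r z₀ z₁
    obtain ⟨t, ht⟩ := exists_eq_add_pow_zero T.hq y₀ y₂
    have key := count₂_add T.hq T.hr T.hqr (a := 0) (by ring) h' ht z₀ z₂
    have hpos : 0 < count₂ B q r y₀ z₀ := count₂_pos_iff.2 ⟨b, hb, hby, hbz⟩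
    have h1 : ¬ 0 < count₂ B q r y₀ z₂ := by
      rw [count₂_pos_iff]
      rintro ⟨n, hn, hny, hnz⟩
      have := hmem n hn
      rw [hnz] at this
      tauto
    have h2 : ¬ 0 < count₂ B q r y₂ z₀ := by
      rw [count₂_pos_iff]
      rintro ⟨n, hn, hny, hnz⟩
      have := hmem n hn
      rw [hny] at this
      tauto
    omega
  have hpos : 0 < count₁ A r z := by
    rw [count₁_eq_of_card T.hr (p := r) (q := p) (r := q) (by rw [T.card_left]; ring) hAr]
    exact Nat.mul_pos T.hp.pos T.hq.pos
  obtain ⟨a, ha, haz⟩ := count₁_pos_iff.1 hpos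
  obtain ⟨t, ht⟩ := exists_eq_add_pow_zero T.hq (a : ZMod q) y
  rw [← count₂_pos_iff, ← count₂_eq T.hq T.hr T.hqr (a := 0) (by ring) hAq hAqr ht,
    count₂_pos_iff]
  exact ⟨a, ha, rfl, haz⟩

theorem not_cyclotomic_right_of_tetrahedral (T : TilingPair p q r A B)
    (hB : TetrahedralType B p q r) : ¬ cyclotomic p ℤ ∣ maskPoly B := by
  intro h
  have hp2 := T.eq_two_of_tetrahedral hB h
  have hAq : cyclotomic q ℤ ∣ maskPoly A :=
    T.swap_left.left_of_not_right ⟨p ^ 2 * q * r ^ 2, by ring⟩ dvd_rfl fun h' =>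
      T.hpq (hp2.trans (T.swap_left.eq_two_of_tetrahedral hB.swap_left h').symm)
  have hAr : cyclotomic r ℤ ∣ maskPoly A :=
    T.swap_right.swap_left.left_of_not_right ⟨p ^ 2 * q ^ 2 * r, by ring⟩ dvd_rfl fun h' =>
      T.hpr (hp2.trans
        (T.swap_right.swap_left.eq_two_of_tetrahedral hB.swap_right.swap_left h').symm)
  have hq' : ∀ a ∈ A, ∀ b ∈ A, (a : ZMod q) = b → (a : ZMod p) = b ∨ (a : ZMod r) = b :=
    fun a ha b hb => T.agree_left_of_tetrahedral hB h hAq ha hb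
  have hr' : ∀ a ∈ A, ∀ b ∈ A, (a : ZMod r) = b → (a : ZMod p) = b ∨ (a : ZMod q) = b :=
    fun a ha b hb => T.swap_right.agree_left_of_tetrahedral hB.swap_right h hAr ha hb
  have hex := T.exists_mem_left_of_tetrahedral hB hp2 hAq hAr
  have hA := T.first.left_not_const
  push Not at hA
  obtain ⟨a, ha, -⟩ := hA 0
  obtain ⟨b, hb, hba⟩ := hA a
  have := Fact.mk T.hq.one_lt
  have := Fact.mk T.hr.one_lt
  -- In the consistent cases a third element `c` shares exactly one of the residues modulo `q`, `r`
  -- with `a` and one with `b`; it is then congruent to both modulo `p`.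
  by_cases h1 : (a : ZMod q) = b
  · have h2 := (hq' a ha b hb h1).resolve_left hba.symm
    obtain ⟨z, hz⟩ := exists_ne (a : ZMod r)
    obtain ⟨c, hc, hcq, hcr⟩ := hex a z
    have e1 := (hq' c hc a ha hcq).resolve_right (hcr ▸ hz)
    have e2 := (hq' c hc b hb (hcq.trans h1)).resolve_right (by rw [hcr, ← h2]; exact hz)
    exact hba (e2.symm.trans e1)
  · by_cases h2 : (a : ZMod r) = b
    · obtain ⟨y, hy⟩ := exists_ne (a : ZMod q)
      exact h1 ((hr' a ha b hb h2).resolve_left hba.symm)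
    · obtain ⟨c, hc, hcq, hcr⟩ := hex a b
      have e1 := (hq' c hc a ha hcq).resolve_right (by rw [hcr]; exact Ne.symm h2)
      have e2 := (hr' c hc b hb hcr).resolve_right (by rwa [hcq])
      exact hba (e2.symm.trans e1)

/-! ### Assembling the residue statements -/

theorem right_type (T : TilingPair p q r A B) : MajorityType B p q r ∨ TetrahedralType B p q r :=
  majorityType_or_tetrahedralType T.agree T.first.right_not_const T.second.right_not_const
    T.third.right_not_const

theorem cyclotomic_dvd_left (T : TilingPair p q r A B) : cyclotomic p ℤ ∣ maskPoly A :=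
  T.left_of_not_right ⟨p * q ^ 2 * r ^ 2, by ring⟩ dvd_rfl (T.right_type.elim
    T.not_cyclotomic_right_of_majority T.not_cyclotomic_right_of_tetrahedral)

theorem uniformOver_of_lt (T : TilingPair p q r A B) (hpq : p < q) (hpr : p < r) :
    UniformOver A p q r := by
  have h₁ := T.cyclotomic_dvd_left
  have h₂ := T.swap_left.cyclotomic_dvd_left
  have h₃ := T.swap_right.swap_left.cyclotomic_dvd_left
  have hA : DiffPrimeSq A p q r :=
    (diffPrime_or_diffPrimeSq_of_lt T.hp T.hq T.hr hpq hpr T.card_left h₁ h₂ h₃).resolve_left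
      fun h => T.first.diffPrime h (T.diffPrime_right h₁)
  have hB := T.first.diffPrimeSq hA
  exact T.right_type.elim (fun h => T.uniformOver_of_majority hpq h h₁ h₂ hB)
    fun h => T.uniformOver_of_tetrahedral h h₁ hB

theorem exists_mem_left (T : TilingPair p q r A B) (x : ZMod p) (y : ZMod q) (z : ZMod r) :
    ∃ a ∈ A, (a : ZMod p) = x ∧ (a : ZMod q) = y ∧ (a : ZMod r) = z := by
  rcases lt_or_gt_of_ne T.hpq with h | h
  · rcases lt_or_gt_of_ne T.hpr with h' | h'
    · exact (T.uniformOver_of_lt h h').exists_mem x y z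
    · obtain ⟨a, ha, e1, e2, e3⟩ :=
        (T.swap_right.swap_left.uniformOver_of_lt h' (h'.trans h)).exists_mem z x y
      exact ⟨a, ha, e2, e3, e1⟩
  · rcases lt_or_gt_of_ne T.hqr with h' | h'
    · obtain ⟨a, ha, e1, e2, e3⟩ := (T.swap_left.uniformOver_of_lt h h').exists_mem y x z
      exact ⟨a, ha, e2, e1, e3⟩
    · obtain ⟨a, ha, e1, e2, e3⟩ :=
        (T.swap_right.swap_left.uniformOver_of_lt (h'.trans h) h').exists_mem z x y
      exact ⟨a, ha, e2, e3, e1⟩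

/-- A complete residue system has a pair that agrees modulo `p` only. It is of type $p$ or $p^2$,
and type $p$ already occurs in $B$. -/
theorem not_diffPrimeSq_right (T : TilingPair p q r A B) : ¬ DiffPrimeSq B p q r := by
  have := Fact.mk T.hq.one_lt
  have := Fact.mk T.hr.one_lt
  obtain ⟨a, ha, hap, haq, har⟩ := T.exists_mem_left 0 0 0
  obtain ⟨b, hb, hbp, hbq, hbr⟩ := T.exists_mem_left 0 1 1
  refine T.first.diffPrimeSq ((diffPrime_or_diffPrimeSq ha hb (hap.trans hbp.symm) ?_ ?_).resolve_left
    fun h => T.first.diffPrime h (T.diffPrime_right T.cyclotomic_dvd_left))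
  · rw [haq, hbq]; exact zero_ne_one
  · rw [har, hbr]; exact zero_ne_one

end TilingPair

/-! ### Factorizations of ZMod M: cyclotomic divisors, dilations, Sands' theorem -/

section Factorization

variable {M : ℕ} [NeZero M] {A B : Finset (ZMod M)}

theorem IsFactorization.sum_eq (h : IsFactorization A B) {R : Type*} [AddCommMonoid R]
    (f : ZMod M → R) : ∑ ab ∈ A ×ˢ B, f (ab.1 + ab.2) = ∑ g, f g := by
  refine Finset.sum_bij (fun ab _ => ab.1 + ab.2) (fun _ _ => Finset.mem_univ _) ?_ ?_
    (fun _ _ => rfl)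
  · intro x hx y hy hxy
    rw [Finset.mem_product] at hx hy
    exact (h (x.1 + x.2)).unique ⟨hx.1, hx.2, rfl⟩ ⟨hy.1, hy.2, hxy.symm⟩
  · intro g _
    obtain ⟨x, ⟨h1, h2, h3⟩, -⟩ := h g
    exact ⟨x, Finset.mem_product.2 ⟨h1, h2⟩, h3⟩

theorem IsFactorization.card_mul_card (h : IsFactorization A B) : A.card * B.card = M := by
  have := h.sum_eq fun _ => 1
  simpa [ZMod.card] using this

theorem isFactorization_of_forall_exists (hcard : A.card * B.card = M)
    (h : ∀ g, ∃ a ∈ A, ∃ b ∈ B, a + b = g) : IsFactorization A B := by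
  have hinj : Set.InjOn (fun ab : ZMod M × ZMod M => ab.1 + ab.2) (A ×ˢ B : Finset _) := by
    refine Finset.injOn_of_surjOn_of_card_le (t := Finset.univ) _
      (fun _ _ => Finset.mem_coe.2 (Finset.mem_univ _)) (fun g _ => ?_) ?_
    · obtain ⟨a, ha, b, hb, hab⟩ := h g
      exact ⟨(a, b), Finset.mem_coe.2 (Finset.mem_product.2 ⟨ha, hb⟩), hab⟩
    · rw [Finset.card_product, hcard, Finset.card_univ, ZMod.card]
  intro g
  obtain ⟨a, ha, b, hb, hab⟩ := h g
  refine ⟨(a, b), ⟨ha, hb, hab⟩, fun x hx => ?_⟩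
  exact hinj (Finset.mem_coe.2 (Finset.mem_product.2 ⟨hx.1, hx.2.1⟩))
    (Finset.mem_coe.2 (Finset.mem_product.2 ⟨ha, hb⟩)) (hx.2.2.trans hab.symm)

theorem X_pow_sub_one_dvd_X_pow_sub_X_pow_mod (M n : ℕ) :
    (X ^ M - 1 : ℤ[X]) ∣ X ^ n - X ^ (n % M) := by
  have : (X ^ n - X ^ (n % M) : ℤ[X]) = X ^ (n % M) * ((X ^ M) ^ (n / M) - 1) := by
    rw [mul_sub, mul_one, ← pow_mul, ← pow_add, Nat.mod_add_div]
  rw [this]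
  exact dvd_mul_of_dvd_right (sub_one_dvd_pow_sub_one _ _) _

theorem IsFactorization.X_pow_sub_one_dvd (h : IsFactorization A B) :
    (X ^ M - 1 : ℤ[X]) ∣ charPoly A * charPoly B - ∑ i ∈ Finset.range M, X ^ i := by
  have h1 : ∑ i ∈ Finset.range M, (X ^ i : ℤ[X]) = ∑ ab ∈ A ×ˢ B, X ^ (ab.1 + ab.2).val := by
    rw [h.sum_eq fun g => (X ^ g.val : ℤ[X])]
    symm
    refine Finset.sum_bij (fun g _ => g.val) (fun g _ => Finset.mem_range.2 g.val_lt)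
      (fun _ _ _ _ h => ZMod.val_injective M h) (fun i hi => ?_) (fun _ _ => rfl)
    exact ⟨(i : ZMod M), Finset.mem_univ _, ZMod.val_cast_of_lt (Finset.mem_range.1 hi)⟩
  rw [h1, charPoly, charPoly, Finset.sum_mul_sum, ← Finset.sum_product', ← Finset.sum_sub_distrib]
  refine Finset.dvd_sum fun ab _ => ?_
  rw [← pow_add, ZMod.val_add]
  exact X_pow_sub_one_dvd_X_pow_sub_X_pow_mod _ _

theorem IsFactorization.cyclotomic_dvd (h : IsFactorization A B) {s : ℕ} (hs : s ∣ M)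
    (hs1 : s ≠ 1) : cyclotomic s ℤ ∣ charPoly A ∨ cyclotomic s ℤ ∣ charPoly B := by
  have hM : 0 < M := Nat.pos_of_ne_zero (NeZero.ne M)
  have hs0 : 0 < s := Nat.pos_of_dvd_of_pos hs hM
  refine (cyclotomic.irreducible hs0).prime.dvd_or_dvd ?_
  rw [← sub_add_cancel (charPoly A * charPoly B) (∑ i ∈ Finset.range M, X ^ i)]
  refine dvd_add ?_ (cyclotomic_dvd_geom_sum_of_dvd ℤ hs hs1)
  refine dvd_trans ?_ h.X_pow_sub_one_dvd
  rw [← prod_cyclotomic_eq_X_pow_sub_one hM]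
  exact Finset.dvd_prod_of_mem _ (Nat.mem_divisors.2 ⟨hs, hM.ne'⟩)

/-- The group algebra element `∑_{a ∈ E} [a]`. -/
noncomputable def groupSum (R : Type*) [Semiring R] (E : Finset (ZMod M)) :
    AddMonoidAlgebra R (ZMod M) := ∑ a ∈ E, AddMonoidAlgebra.single a 1

theorem single_mul_groupSum_univ (R : Type*) [Semiring R] (a : ZMod M) :
    AddMonoidAlgebra.single a 1 * groupSum R Finset.univ = groupSum R Finset.univ := by
  rw [groupSum, Finset.mul_sum]
  simp only [AddMonoidAlgebra.single_mul_single, mul_one]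
  exact Equiv.sum_comp (Equiv.addLeft a) fun g => AddMonoidAlgebra.single g (1 : R)

theorem groupSum_pow_mul_univ (R : Type*) [CommSemiring R] (E : Finset (ZMod M)) (k : ℕ) :
    groupSum R E ^ k * groupSum R Finset.univ = (E.card ^ k) • groupSum R Finset.univ := by
  induction k with
  | zero => simp
  | succ k ih =>
    have h1 : groupSum R E * groupSum R Finset.univ = E.card • groupSum R Finset.univ := by
      conv_lhs => rw [groupSum]
      rw [Finset.sum_mul, Finset.sum_congr rfl fun a _ => single_mul_groupSum_univ R a,
        Finset.sum_const]
    rw [pow_succ, mul_assoc, h1, mul_smul_comm, ih, smul_smul, pow_succ, mul_comm]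

theorem IsFactorization.groupSum_mul (h : IsFactorization A B) (R : Type*) [CommSemiring R] :
    groupSum R A * groupSum R B = groupSum R Finset.univ := by
  unfold groupSum
  rw [Finset.sum_mul_sum, ← Finset.sum_product']
  simp only [AddMonoidAlgebra.single_mul_single, mul_one]
  exact h.sum_eq fun g => AddMonoidAlgebra.single g (1 : R)

/-- In characteristic $l$, Frobenius turns $A^l$ into the sum over $lA$. With $G$ the sum of all
group elements, $A^lB=|A|^{l-1}G$, whose coefficients are nonzero because $|A|$ divides $M$. So
$lA+B$ is everything, and counting gives uniqueness. -/
theorem IsFactorization.image_mul_prime (h : IsFactorization A B) {l : ℕ} (hl : l.Prime)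
    (hlM : l.Coprime M) : IsFactorization (A.image fun a => (l : ZMod M) * a) B := by
  have hfact := Fact.mk hl
  have hinj : Function.Injective fun a : ZMod M => (l : ZMod M) * a :=
    ((ZMod.isUnit_iff_coprime l M).2 hlM).mul_right_injective
  refine isFactorization_of_forall_exists ?_ fun g => ?_
  · rw [Finset.card_image_of_injective _ hinj, h.card_mul_card]
  have hchar : CharP (AddMonoidAlgebra (ZMod l) (ZMod M)) l :=
    charP_of_injective_algebraMap
      (FaithfulSMul.algebraMap_injective (ZMod l) (AddMonoidAlgebra (ZMod l) (ZMod M))) l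
  have hpow : groupSum (ZMod l) A ^ l =
      ∑ a ∈ A, AddMonoidAlgebra.single ((l : ZMod M) * a) (1 : ZMod l) := by
    rw [groupSum, sum_pow_char]
    refine Finset.sum_congr rfl fun a _ => ?_
    rw [AddMonoidAlgebra.single_pow, one_pow, nsmul_eq_mul]
  have hkey : groupSum (ZMod l) A ^ l * groupSum (ZMod l) B =
      (A.card ^ (l - 1)) • groupSum (ZMod l) Finset.univ := by
    obtain ⟨k, hk⟩ : ∃ k, l = k + 1 := ⟨l - 1, (Nat.sub_add_cancel hl.one_le).symm⟩
    have hk' : l - 1 = k := by omega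
    have : groupSum (ZMod l) A ^ l = groupSum (ZMod l) A ^ k * groupSum (ZMod l) A := by
      rw [← pow_succ, ← hk]
    rw [this, mul_assoc, h.groupSum_mul, groupSum_pow_mul_univ, hk']
  rw [hpow, groupSum, Finset.sum_mul_sum, ← Finset.sum_product'] at hkey
  simp only [AddMonoidAlgebra.single_mul_single, mul_one] at hkey
  by_contra hno
  push Not at hno
  have hcoef := congrArg (fun x : AddMonoidAlgebra (ZMod l) (ZMod M) => x.coeff g) hkey
  simp only [groupSum, AddMonoidAlgebra.coeff_sum, AddMonoidAlgebra.coeff_smul_apply,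
    Finsupp.finsetSum_apply, AddMonoidAlgebra.coeff_single, Finsupp.single_apply, Finset.sum_ite_eq',
    Finset.mem_univ, if_true] at hcoef
  rw [Finset.sum_eq_zero] at hcoef
  · rw [nsmul_eq_mul, mul_one, eq_comm, ZMod.natCast_eq_zero_iff] at hcoef
    exact hl.coprime_iff_not_dvd.1 hlM
      (h.card_mul_card ▸ (hl.dvd_of_dvd_pow hcoef).mul_right B.card)
  · intro x hx
    rw [Finset.mem_product] at hx
    exact if_neg (hno _ (Finset.mem_image_of_mem _ hx.1) _ hx.2)

theorem IsFactorization.image_mul (h : IsFactorization A B) (hM : 1 < M) {t : ℕ}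
    (ht : t.Coprime M) : IsFactorization (A.image fun a => (t : ZMod M) * a) B := by
  induction t using Nat.recOnMul generalizing A with
  | zero => exact absurd (Nat.coprime_zero_left M |>.1 ht) hM.ne'
  | one => simpa using h
  | prime l hl => exact h.image_mul_prime hl ht
  | mul s t hs ht' =>
    have := ht' (hs h (Nat.Coprime.coprime_mul_right ht)) (Nat.Coprime.coprime_mul_left ht)
    rw [Finset.image_image] at this
    convert this using 2
    funext a
    simp only [Function.comp_apply]
    push_cast
    ring

theorem gcd_val_unit_mul {u : ZMod M} (hu : IsUnit u) {d : ℕ} (hd : d ∣ M) :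
    Nat.gcd (u * d).val M = d := by
  have hc : u.val.Coprime M := by
    have := ZMod.val_coe_unit_coprime hu.unit
    rwa [hu.unit_spec] at this
  have : (u * d) = ((u.val * d : ℕ) : ZMod M) := by
    rw [Nat.cast_mul, ZMod.natCast_zmod_val]
  rw [this, ZMod.val_natCast, (Nat.mod_modEq _ M).gcd_eq, hc.gcd_mul_left_cancel,
    Nat.gcd_eq_left hd]

theorem exists_coprime_mul_eq {x y : ZMod M} (h : Nat.gcd x.val M = Nat.gcd y.val M) :
    ∃ t : ℕ, t.Coprime M ∧ (t : ZMod M) * x = y := by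
  obtain ⟨d, hd, u, hu, rfl⟩ := ZMod.eq_unit_mul_divisor x
  obtain ⟨e, he, v, hv, rfl⟩ := ZMod.eq_unit_mul_divisor y
  rw [gcd_val_unit_mul hu hd, gcd_val_unit_mul hv he] at h
  subst h
  refine ⟨(v * ((hu.unit⁻¹ : (ZMod M)ˣ) : ZMod M)).val, ?_, ?_⟩
  · have := ZMod.val_coe_unit_coprime (hv.unit * hu.unit⁻¹)
    rwa [Units.val_mul, hv.unit_spec] at this
  · rw [ZMod.natCast_zmod_val, mul_assoc, ← mul_assoc _ u, IsUnit.val_inv_mul, one_mul]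

/-- Equal gcds give $t(a-a')=b-b'$ with $t$ coprime to $M$, so $ta+b'=ta'+b$ are two representations
in $tA\oplus B$. -/
theorem IsFactorization.eq_of_gcd_eq (h : IsFactorization A B) (hM : 1 < M) {a a' b b' : ZMod M}
    (ha : a ∈ A) (ha' : a' ∈ A) (hb : b ∈ B) (hb' : b' ∈ B)
    (hgcd : Nat.gcd (a - a').val M = Nat.gcd (b - b').val M) : b = b' := by
  obtain ⟨t, ht, hab⟩ := exists_coprime_mul_eq hgcd
  have hu := (h.image_mul hM ht ((t : ZMod M) * a + b')).unique
    (y₁ := ((t : ZMod M) * a, b')) (y₂ := ((t : ZMod M) * a', b))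
    ⟨Finset.mem_image_of_mem _ ha, hb', rfl⟩
    ⟨Finset.mem_image_of_mem _ ha', hb, by linear_combination -hab⟩
  exact (Prod.ext_iff.1 hu).2.symm

theorem dvd_val_sub_iff {n : ℕ} (hn : n ∣ M) (a b : ZMod M) :
    n ∣ (a - b).val ↔ (a.val : ZMod n) = (b.val : ZMod n) := by
  have hc : ∀ x : ZMod M, (x.val : ZMod n) = ZMod.castHom hn (ZMod n) x := fun x => by
    rw [ZMod.castHom_apply, ZMod.natCast_val]
  rw [← ZMod.natCast_eq_zero_iff, hc, hc, hc, map_sub, sub_eq_zero]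

end Factorization

/-! ### From division sets to residue conditions -/

section Residues

variable {M p q r : ℕ}

theorem gcd_eq_prime (hp : p.Prime) (hq : q.Prime) (hr : r.Prime) (hM : M = (p * q * r) ^ 2)
    {n : ℕ} (h1 : p ∣ n) (h2 : ¬ p ^ 2 ∣ n) (h3 : ¬ q ∣ n) (h4 : ¬ r ∣ n) : Nat.gcd n M = p := by
  obtain ⟨k, rfl⟩ := h1
  rw [hM, show (p * q * r) ^ 2 = p * (p * q ^ 2 * r ^ 2) by ring, Nat.gcd_mul_left]
  have e1 : k.Coprime p := ((Nat.Prime.coprime_iff_not_dvd hp).2 fun ⟨j, hj⟩ =>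
    h2 ⟨j, by rw [hj]; ring⟩).symm
  have e2 : k.Coprime q := ((Nat.Prime.coprime_iff_not_dvd hq).2 fun h =>
    h3 (h.mul_left p)).symm
  have e3 : k.Coprime r := ((Nat.Prime.coprime_iff_not_dvd hr).2 fun h =>
    h4 (h.mul_left p)).symm
  have : k.Coprime (p * q ^ 2 * r ^ 2) :=
    (e1.mul_right (e2.pow_right 2)).mul_right (e3.pow_right 2)
  rw [this.gcd_eq_one, mul_one]

theorem gcd_eq_prime_sq (hq : q.Prime) (hr : r.Prime) (hM : M = (p * q * r) ^ 2)
    {n : ℕ} (h1 : p ^ 2 ∣ n) (h3 : ¬ q ∣ n) (h4 : ¬ r ∣ n) : Nat.gcd n M = p ^ 2 := by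
  obtain ⟨k, rfl⟩ := h1
  rw [hM, show (p * q * r) ^ 2 = p ^ 2 * (q ^ 2 * r ^ 2) by ring, Nat.gcd_mul_left]
  have e2 : k.Coprime q := ((Nat.Prime.coprime_iff_not_dvd hq).2 fun h =>
    h3 (h.mul_left (p ^ 2))).symm
  have e3 : k.Coprime r := ((Nat.Prime.coprime_iff_not_dvd hr).2 fun h =>
    h4 (h.mul_left (p ^ 2))).symm
  have : k.Coprime (q ^ 2 * r ^ 2) := (e2.pow_right 2).mul_right (e3.pow_right 2)
  rw [this.gcd_eq_one, mul_one]

theorem not_dvd_of_gcd_eq {n d : ℕ} (hqM : q ∣ M) (h : d = Nat.gcd n M)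
    (hd : ¬ q ∣ d) : ¬ q ∣ n := fun hn => hd (h ▸ Nat.dvd_gcd hn hqM)

variable [NeZero M]

theorem natCast_val_eq_iff (hd : p ∣ M) (a b : ZMod M) :
    (a.val : ZMod p) = (b.val : ZMod p) ↔ p ∣ (a - b).val := (dvd_val_sub_iff hd a b).symm

theorem charPoly_eq_maskPoly (E : Finset (ZMod M)) : charPoly E = maskPoly (E.image ZMod.val) := by
  rw [charPoly, maskPoly, Finset.sum_image fun _ _ _ _ h => ZMod.val_injective M h]

/-- As `0 ∈ E`, a constant residue is `0`, and `E` lies in the kernel of reduction modulo `p`. -/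
theorem not_const_of_not_inProperSubgroup (hp : p.Prime) (hpM : p ∣ M) {E : Finset (ZMod M)}
    (h0 : 0 ∈ E) (hE : ¬ InProperSubgroup E) :
    ¬ ∃ x : ZMod p, ∀ n ∈ E.image ZMod.val, (n : ZMod p) = x := by
  rintro ⟨x, hx⟩
  have := Fact.mk hp.one_lt
  refine hE ⟨(ZMod.castHom hpM (ZMod p)).toAddMonoidHom.ker, fun htop => ?_, fun a ha => ?_⟩
  · have h1 : (1 : ZMod M) ∈ (ZMod.castHom hpM (ZMod p)).toAddMonoidHom.ker := htop ▸ trivial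
    rw [AddMonoidHom.mem_ker] at h1
    exact one_ne_zero ((map_one (ZMod.castHom hpM (ZMod p))).symm.trans h1)
  · have h1 := hx _ (Finset.mem_image_of_mem _ ha)
    rw [← hx _ (Finset.mem_image_of_mem _ h0), natCast_val_eq_iff hpM, sub_zero,
      ← ZMod.natCast_eq_zero_iff, ZMod.natCast_val] at h1
    exact h1

theorem exists_gcd_eq_prime (hp : p.Prime) (hq : q.Prime) (hr : r.Prime)
    (hM : M = (p * q * r) ^ 2) {E : Finset (ZMod M)} (h : DiffPrime (E.image ZMod.val) p q r) :
    ∃ a ∈ E, ∃ b ∈ E, Nat.gcd (a - b).val M = p ∧ a ≠ b := by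
  obtain ⟨_, haE, _, hbE, h1, h2, h3, h4⟩ := h
  obtain ⟨a, ha, rfl⟩ := Finset.mem_image.1 haE
  obtain ⟨b, hb, rfl⟩ := Finset.mem_image.1 hbE
  rw [natCast_val_eq_iff ⟨p * q ^ 2 * r ^ 2, by rw [hM]; ring⟩] at h1
  rw [Ne, natCast_val_eq_iff ⟨q ^ 2 * r ^ 2, by rw [hM]; ring⟩] at h2
  refine ⟨a, ha, b, hb, ?_, by rintro rfl; exact h3 rfl⟩
  rw [Ne, natCast_val_eq_iff ⟨p ^ 2 * q * r ^ 2, by rw [hM]; ring⟩] at h3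
  rw [Ne, natCast_val_eq_iff ⟨p ^ 2 * q ^ 2 * r, by rw [hM]; ring⟩] at h4
  exact gcd_eq_prime hp hq hr hM h1 h2 h3 h4

theorem exists_gcd_eq_prime_sq (hq : q.Prime) (hr : r.Prime)
    (hM : M = (p * q * r) ^ 2) {E : Finset (ZMod M)} (h : DiffPrimeSq (E.image ZMod.val) p q r) :
    ∃ a ∈ E, ∃ b ∈ E, Nat.gcd (a - b).val M = p ^ 2 ∧ a ≠ b := by
  obtain ⟨_, haE, _, hbE, h1, h3, h4⟩ := h
  obtain ⟨a, ha, rfl⟩ := Finset.mem_image.1 haE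
  obtain ⟨b, hb, rfl⟩ := Finset.mem_image.1 hbE
  rw [natCast_val_eq_iff ⟨q ^ 2 * r ^ 2, by rw [hM]; ring⟩] at h1
  refine ⟨a, ha, b, hb, ?_, by rintro rfl; exact h3 rfl⟩
  rw [Ne, natCast_val_eq_iff ⟨p ^ 2 * q * r ^ 2, by rw [hM]; ring⟩] at h3
  rw [Ne, natCast_val_eq_iff ⟨p ^ 2 * q ^ 2 * r, by rw [hM]; ring⟩] at h4
  exact gcd_eq_prime_sq hq hr hM h1 h3 h4

theorem diffPrimeSq_of_mem_divisionSet (hp : p.Prime) (hq : q.Prime) (hr : r.Prime)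
    (hpq : p ≠ q) (hpr : p ≠ r) (hM : M = (p * q * r) ^ 2) {E : Finset (ZMod M)}
    (h : p ^ 2 ∈ divisionSet E) : DiffPrimeSq (E.image ZMod.val) p q r := by
  obtain ⟨a, ha, b, hb, hab⟩ := h
  refine ⟨_, Finset.mem_image_of_mem _ ha, _, Finset.mem_image_of_mem _ hb, ?_, ?_, ?_⟩
  · rw [natCast_val_eq_iff ⟨q ^ 2 * r ^ 2, by rw [hM]; ring⟩, hab]
    exact Nat.gcd_dvd_left _ _
  · have hd : q ∣ M := ⟨p ^ 2 * q * r ^ 2, by rw [hM]; ring⟩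
    rw [Ne, natCast_val_eq_iff hd]
    exact not_dvd_of_gcd_eq hd hab fun h =>
      hpq.symm ((Nat.prime_dvd_prime_iff_eq hq hp).1 (hq.dvd_of_dvd_pow h))
  · have hd : r ∣ M := ⟨p ^ 2 * q ^ 2 * r, by rw [hM]; ring⟩
    rw [Ne, natCast_val_eq_iff hd]
    exact not_dvd_of_gcd_eq hd hab fun h =>
      hpr.symm ((Nat.prime_dvd_prime_iff_eq hr hp).1 (hr.dvd_of_dvd_pow h))

variable {A B : Finset (ZMod M)}

theorem primeConditions (hp : p.Prime) (hq : q.Prime) (hr : r.Prime) (hM : M = (p * q * r) ^ 2)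
    (hM1 : 1 < M) (hAB : IsFactorization A B) (h0A : 0 ∈ A) (h0B : 0 ∈ B)
    (hA : ¬ InProperSubgroup A) (hB : ¬ InProperSubgroup B) :
    PrimeConditions p q r (A.image ZMod.val) (B.image ZMod.val) := by
  have hpM : p ∣ M := ⟨p * q ^ 2 * r ^ 2, by rw [hM]; ring⟩
  refine ⟨not_const_of_not_inProperSubgroup hp hpM h0A hA,
    not_const_of_not_inProperSubgroup hp hpM h0B hB, fun h1 h2 => ?_, fun h1 h2 => ?_⟩
  · obtain ⟨a, ha, a', ha', hd, -⟩ := exists_gcd_eq_prime hp hq hr hM h1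
    obtain ⟨b, hb, b', hb', hd', hne⟩ := exists_gcd_eq_prime hp hq hr hM h2
    exact hne (hAB.eq_of_gcd_eq hM1 ha ha' hb hb' (hd.trans hd'.symm))
  · obtain ⟨a, ha, a', ha', hd, -⟩ := exists_gcd_eq_prime_sq hq hr hM h1
    obtain ⟨b, hb, b', hb', hd', hne⟩ := exists_gcd_eq_prime_sq hq hr hM h2
    exact hne (hAB.eq_of_gcd_eq hM1 ha ha' hb hb' (hd.trans hd'.symm))

theorem tilingPair (hp : p.Prime) (hq : q.Prime) (hr : r.Prime) (hpq : p ≠ q) (hqr : q ≠ r)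
    (hpr : p ≠ r) (hM : M = (p * q * r) ^ 2) (hAB : IsFactorization A B)
    (hA : A.card = p * q * r) (hB : B.card = p * q * r) (h0A : 0 ∈ A) (h0B : 0 ∈ B)
    (hAsub : ¬ InProperSubgroup A) (hBsub : ¬ InProperSubgroup B) (h1 : 1 ∉ divisionSet B) :
    TilingPair p q r (A.image ZMod.val) (B.image ZMod.val) := by
  have hM1 : 1 < M := by
    rw [hM]
    refine Nat.one_lt_pow two_ne_zero ?_
    exact Nat.lt_of_lt_of_le hp.one_lt
      (Nat.le_of_dvd (Nat.mul_pos (Nat.mul_pos hp.pos hq.pos) hr.pos) ⟨q * r, by ring⟩)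
  refine ⟨hp, hq, hr, hpq, hqr, hpr, ?_, ?_, ?_, ?_, ?_, ?_, ?_⟩
  · rw [Finset.card_image_of_injective _ (ZMod.val_injective M), hA]
  · rw [Finset.card_image_of_injective _ (ZMod.val_injective M), hB]
  · intro s hs hs1
    rw [← charPoly_eq_maskPoly, ← charPoly_eq_maskPoly]
    exact hAB.cyclotomic_dvd (hM ▸ hs) hs1
  · intro _ haE _ hbE
    obtain ⟨a, ha, rfl⟩ := Finset.mem_image.1 haE
    obtain ⟨b, hb, rfl⟩ := Finset.mem_image.1 hbE
    by_contra hne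
    rw [natCast_val_eq_iff ⟨p * q ^ 2 * r ^ 2, by rw [hM]; ring⟩,
      natCast_val_eq_iff ⟨p ^ 2 * q * r ^ 2, by rw [hM]; ring⟩,
      natCast_val_eq_iff ⟨p ^ 2 * q ^ 2 * r, by rw [hM]; ring⟩] at hne
    push Not at hne
    refine h1 ⟨a, ha, b, hb, Eq.symm ?_⟩
    have hc : ∀ l : ℕ, l.Prime → ¬ l ∣ (a - b).val → (a - b).val.Coprime l :=
      fun l hl h => ((Nat.Prime.coprime_iff_not_dvd hl).2 h).symm
    have := (((hc p hp hne.1).mul_right (hc q hq hne.2.1)).mul_right (hc r hr hne.2.2)).pow_right 2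
    rw [← hM] at this
    exact this
  · exact primeConditions hp hq hr hM hM1 hAB h0A h0B hAsub hBsub
  · exact primeConditions hq hp hr (by rw [hM]; ring) hM1 hAB h0A h0B hAsub hBsub
  · exact primeConditions hr hp hq (by rw [hM]; ring) hM1 hAB h0A h0B hAsub hBsub

/-- $A$ is injective modulo $pqr$, so a difference divisible by $pqr$ is zero and its gcd is $M$. -/
theorem notMem_divisionSet_of_lt (T : TilingPair p q r (A.image ZMod.val) (B.image ZMod.val))
    (hM : M = (p * q * r) ^ 2) (hpq : p < q) (hpr : p < r) {d : ℕ} (hd : p * q * r ∣ d)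
    (hdM : d < M) : d ∉ divisionSet A := by
  rintro ⟨a, ha, b, hb, hab⟩
  have hdv : d ∣ (a - b).val := hab ▸ Nat.gcd_dvd_left _ _
  have hmem := (T.uniformOver_of_lt hpq hpr).eq (Finset.mem_image_of_mem _ ha)
    (Finset.mem_image_of_mem _ hb)
    ((natCast_val_eq_iff ⟨p * q ^ 2 * r ^ 2, by rw [hM]; ring⟩ a b).2
      (dvd_trans ⟨q * r, by ring⟩ (hd.trans hdv)))
    ((natCast_val_eq_iff ⟨p ^ 2 * q * r ^ 2, by rw [hM]; ring⟩ a b).2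
      (dvd_trans ⟨p * r, by ring⟩ (hd.trans hdv)))
    ((natCast_val_eq_iff ⟨p ^ 2 * q ^ 2 * r, by rw [hM]; ring⟩ a b).2
      (dvd_trans ⟨p * q, by ring⟩ (hd.trans hdv)))
  have : a = b := ZMod.val_injective M hmem
  subst this
  rw [sub_self, ZMod.val_zero, Nat.gcd_zero_left] at hab
  exact hdM.ne hab

theorem prime_mem_and_sq_notMem_divisionSet (T : TilingPair p q r (A.image ZMod.val) (B.image ZMod.val))
    (hM : M = (p * q * r) ^ 2) : p ∈ divisionSet B ∧ p ^ 2 ∉ divisionSet B := by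
  constructor
  · obtain ⟨a, ha, b, hb, h, -⟩ := exists_gcd_eq_prime T.hp T.hq T.hr hM
      (T.diffPrime_right T.cyclotomic_dvd_left)
    exact ⟨a, ha, b, hb, h.symm⟩
  · exact fun h => T.not_diffPrimeSq_right
      (diffPrimeSq_of_mem_divisionSet T.hp T.hq T.hr T.hpq T.hpr hM h)

end Residues

theorem proposition2p5 (p q r : ℕ) (hp : p.Prime) (hq : q.Prime) (hr : r.Prime)
    (hpq : p ≠ q) (hqr : q ≠ r) (hpr : p ≠ r)
    (A B : Finset (ZMod ((p * q * r) ^ 2)))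
    (hAB : IsFactorization A B)
    (hA : A.card = p * q * r) (hB : B.card = p * q * r)
    (h0A : 0 ∈ A) (h0B : 0 ∈ B)
    (hAsub : ¬ InProperSubgroup A) (hBsub : ¬ InProperSubgroup B)
    (h1 : 1 ∉ divisionSet B) :
    (cyclotomic p ℤ * cyclotomic q ℤ * cyclotomic r ℤ ∣ charPoly A) ∧
    ((p ∈ divisionSet B ∧ q ∈ divisionSet B ∧ r ∈ divisionSet B) ∧
      (p ^ 2 ∉ divisionSet B ∧ q ^ 2 ∉ divisionSet B ∧ r ^ 2 ∉ divisionSet B)) ∧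
    (p < q → q < r →
      p ^ 2 * q * r ∉ divisionSet A ∧
      p ^ 2 * q ^ 2 * r ∉ divisionSet A ∧
      p ^ 2 * q * r ^ 2 ∉ divisionSet A) := by
  have : NeZero ((p * q * r) ^ 2) :=
    ⟨pow_ne_zero _ (mul_ne_zero (mul_ne_zero hp.ne_zero hq.ne_zero) hr.ne_zero)⟩
  have T := tilingPair hp hq hr hpq hqr hpr rfl hAB hA hB h0A h0B hAsub hBsub h1
  have Cp := prime_mem_and_sq_notMem_divisionSet T rfl
  have Cq := prime_mem_and_sq_notMem_divisionSet T.swap_left (by ring)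
  have Cr := prime_mem_and_sq_notMem_divisionSet T.swap_right.swap_left (by ring)
  refine ⟨?_, ⟨⟨Cp.1, Cq.1, Cr.1⟩, Cp.2, Cq.2, Cr.2⟩, fun hlt hlt' => ?_⟩
  · rw [charPoly_eq_maskPoly]
    have h1 := isRelPrime_cyclotomic hp.pos hq.pos hpq
    have h2 := isRelPrime_cyclotomic hp.pos hr.pos hpr
    have h3 := isRelPrime_cyclotomic hq.pos hr.pos hqr
    exact (h2.mul_left h3).mul_dvd (h1.mul_dvd T.cyclotomic_dvd_left
      T.swap_left.cyclotomic_dvd_left) T.swap_right.swap_left.cyclotomic_dvd_left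
  · have key : ∀ d k, p * q * r ∣ d → 1 < k → 0 < d → d * k = (p * q * r) ^ 2 →
        d ∉ divisionSet A := by
      intro d k hd hk hd0 hdk
      refine notMem_divisionSet_of_lt T rfl hlt (hlt.trans hlt') hd ?_
      rw [← hdk]
      exact lt_mul_right hd0 hk
    have hp0 := hp.pos
    have hq0 := hq.pos
    have hr0 := hr.pos
    refine ⟨key _ (q * r) ⟨p, by ring⟩ ?_ (by positivity) (by ring),
      key _ r ⟨p * q, by ring⟩ hr.one_lt (by positivity) (by ring),
      key _ q ⟨p * r, by ring⟩ hq.one_lt (by positivity) (by ring)⟩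
    exact Nat.one_lt_mul_iff.2 ⟨hq0, hr0, Or.inl hq.one_lt⟩
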